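/- A unit interval order is a finite partially ordered set $U$ isomorphic to a finite set of real numbers ordered by $u\prec w \iff u+1\le w$. Write $u\sim w$ if neither $u\prec w$ nor $w\prec u$ (so $u\sim u$), and let $\mathrm{inc}(U)$ be the graph on $U$ joining incomparable distinct elements. Let $\Lambda$ be the ring of symmetric functions over $\mathbb R$, with its elementary, power sum and monomial symmetric functions $e_i,p_k,m_\lambda$ ($m_\lambda$ is the sum of the distinct monomials with exponents $\lambda$, each taken once). For $f\in\Lambda$ let $f^U\in\mathbb R[U]$ be its image under Stanley's homomorphism $\Lambda\to\mathbb R[U]$, the ring homomorphism with $e_i\mapsto e_i^U=\sum_{S}\prod_{v\in S}v$ for $i\ge 1$, where $S$ runs over the $i$-element stable sets of $\mathrm{inc}(U)$ and the elements of $U$ are commuting variables. A sequence $(w_1,\dots,w_k)$ in $U$ is correct if $w_i\not\succ w_{i+1}$ for $1\le i<k$, and for every $2\le j\le k$ there is $i<j$ with $w_i\not\prec w_j$. For $l\ge 2$ let $P^U_{l,2}$ be the set of pairs $(\vec w\,|\,q_0,q_1)$ in which $\vec w=(w_1,\dots,w_l)$ and $(q_0,q_1)$ are correct; let $\theta=\max\{i<l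 : w_i\sim w_{i+1}\}$ (which exists since $w_1\sim w_2$), and let $M^U_{l,2}\subset P^U_{l,2}$ be the set of pairs such that $$\bigl(w_i\prec q_0\text{ for all } i\le l-1,\ \text{ and } w_l\prec q_1\bigr)\quad\text{or}\quad\bigl(w_\theta\succ q_0\ \text{ and }\ w_{\theta+1}\succ q_1\bigr).$$ **Theorem.** Let $U$ be a unit interval order. For every $l\ge 2$, $$p^U_l\,p^U_2-p^U_{l+2}=\sum_{(\vec w|q_0,q_1)\in M^U_{l,2}}w_1\cdots w_l\,q_0\,q_1 .$$ Consequently $$m^U_{l,2}=\sum_{(\vec w|q_0,q_1)\in M^U_{l,2}}w_1\cdots w_l\,q_0\,q_1\quad(l\ge 3),\qquad 2\,m^U_{2,2}=\sum_{(\vec w|q_0,q_1)\in M^U_{2,2}}w_1w_2\,q_0\,q_1 .$$ Moreover, if $n=|U|\ge 4$ and $X_{\mathrm{inc}(U)}=\sum_\lambda c_\lambda(U)e_\lambda$ is the expansion of the chromatic symmetric function of $\mathrm{inc}(U)$ in the basis of elementary symmetric functions, then $c_{n-2,2}(U)\ge 0$. -/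

import Mathlib

noncomputable section

namespace ChromSym

open MvPolynomial (esymm esymmAlgHom)

/-! ### The ring of symmetric functions in countably many variables -/

/-- The ring `Λ` of symmetric functions over `ℝ` in the variables `x_i`, `i ∈ ℕ`: formal power
series of bounded degree that are invariant under all permutations of the variables. -/
def SymFun : Subalgebra ℝ (MvPowerSeries ℕ ℝ) where
  carrier := {f | (∃ d : ℕ, ∀ α : ℕ →₀ ℕ, d < α.degree → MvPowerSeries.coeff α f = 0) ∧
    ∀ s : Equiv.Perm ℕ, MvPowerSeries.rename s f = f}
  add_mem' := by
    rintro f g ⟨⟨d, hd⟩, hf⟩ ⟨⟨d', hd'⟩, hg⟩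
    refine ⟨⟨max d d', fun α h => ?_⟩, fun s => by rw [map_add, hf, hg]⟩
    rw [map_add, hd α (lt_of_le_of_lt (le_max_left _ _) h),
      hd' α (lt_of_le_of_lt (le_max_right _ _) h), add_zero]
  mul_mem' := by
    classical
    rintro f g ⟨⟨d, hd⟩, hf⟩ ⟨⟨d', hd'⟩, hg⟩
    refine ⟨⟨d + d', fun α h => ?_⟩, fun s => by rw [map_mul, hf, hg]⟩
    rw [MvPowerSeries.coeff_mul]
    refine Finset.sum_eq_zero fun x hx => ?_
    rw [Finset.HasAntidiagonal.mem_antidiagonal] at hx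
    rw [← hx, map_add] at h
    rcases lt_or_ge d x.1.degree with h1 | h1
    · rw [hd _ h1, zero_mul]
    · rw [hd' x.2 (by omega), mul_zero]
  algebraMap_mem' := by
    classical
    intro r
    refine ⟨⟨0, fun α h => ?_⟩, fun s => AlgHom.commutes _ _⟩
    rw [MvPowerSeries.algebraMap_apply, Algebra.algebraMap_self, RingHom.id_apply,
      MvPowerSeries.coeff_C, if_neg]
    rintro rfl
    simp at h

theorem rename_eq_self_iff (s : Equiv.Perm ℕ) (f : MvPowerSeries ℕ ℝ) :
    MvPowerSeries.rename s f = f ↔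
      ∀ α : ℕ →₀ ℕ, MvPowerSeries.coeff (α.embDomain s.toEmbedding) f = MvPowerSeries.coeff α f := by
  constructor
  · intro h α
    conv_lhs => rw [← h]
    exact MvPowerSeries.coeff_embDomain_rename s.toEmbedding f α
  · intro h
    ext β
    obtain ⟨α, rfl⟩ : ∃ α : ℕ →₀ ℕ, α.embDomain s.toEmbedding = β := by
      refine ⟨β.embDomain s.symm.toEmbedding, ?_⟩
      ext i
      obtain ⟨j, rfl⟩ := s.surjective i
      have h1 := Finsupp.embDomain_apply_self s.toEmbedding (β.embDomain s.symm.toEmbedding) j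
      have h2 := Finsupp.embDomain_apply_self s.symm.toEmbedding β (s j)
      simp only [Equiv.coe_toEmbedding, Equiv.symm_apply_apply] at h1 h2
      rw [h1, h2]
    rw [h]
    exact MvPowerSeries.coeff_embDomain_rename s.toEmbedding f α

/-- The symmetric function with prescribed coefficients. -/
def SymFun.mk (c : (ℕ →₀ ℕ) → ℝ) (d : ℕ) (hd : ∀ α, d < α.degree → c α = 0)
    (hs : ∀ (s : Equiv.Perm ℕ) (α : ℕ →₀ ℕ), c (α.embDomain s.toEmbedding) = c α) : SymFun :=
  ⟨(c : MvPowerSeries ℕ ℝ), ⟨d, hd⟩, fun s => (rename_eq_self_iff s _).2 (hs s)⟩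

theorem coeff_mk (c : (ℕ →₀ ℕ) → ℝ) (d : ℕ) (hd : ∀ α, d < α.degree → c α = 0)
    (hs : ∀ (s : Equiv.Perm ℕ) (α : ℕ →₀ ℕ), c (α.embDomain s.toEmbedding) = c α)
    (α : ℕ →₀ ℕ) :
    MvPowerSeries.coeff α (SymFun.mk c d hd hs : MvPowerSeries ℕ ℝ) = c α := rfl

theorem forall_embDomain (s : Equiv.Perm ℕ) (α : ℕ →₀ ℕ) (Q : ℕ → Prop) :
    (∀ i, Q (α.embDomain s.toEmbedding i)) ↔ ∀ i, Q (α i) := by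
  constructor
  · intro h i
    have := h (s i)
    rwa [← Equiv.coe_toEmbedding, Finsupp.embDomain_apply_self] at this
  · intro h i
    obtain ⟨j, rfl⟩ := s.surjective i
    rw [← Equiv.coe_toEmbedding, Finsupp.embDomain_apply_self]
    exact h j

theorem degree_embDomain {σ τ : Type*} (s : σ ↪ τ) (α : σ →₀ ℕ) :
    (α.embDomain s).degree = α.degree := by
  simp [Finsupp.degree_apply]

theorem embDomain_eq_single_iff (s : Equiv.Perm ℕ) (α : ℕ →₀ ℕ) (k : ℕ) :
    (∃ i, α.embDomain s.toEmbedding = Finsupp.single i k) ↔ ∃ i, α = Finsupp.single i k := by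
  constructor
  · rintro ⟨i, hi⟩
    refine ⟨s.symm i, Finsupp.embDomain_injective s.toEmbedding ?_⟩
    rw [hi, Finsupp.embDomain_single]
    simp
  · rintro ⟨i, rfl⟩
    exact ⟨s i, by rw [Finsupp.embDomain_single]; rfl⟩

open Classical in
/-- The elementary symmetric function `e_m = ∑_{i_1 < ⋯ < i_m} x_{i_1} ⋯ x_{i_m}`. -/
def e (m : ℕ) : SymFun :=
  SymFun.mk (fun α => if α.degree = m ∧ ∀ i, α i ≤ 1 then 1 else 0) m
    (fun α h => if_neg fun h' => by omega)
    (fun s α => by rw [degree_embDomain, forall_embDomain s α (fun n => n ≤ 1)])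

open Classical in
/-- The power sum symmetric function `p_k = ∑_i x_i ^ k`, for `k ≥ 1`. -/
def p (k : ℕ) : SymFun :=
  SymFun.mk (fun α => if ∃ i, α = Finsupp.single i k then 1 else 0) k
    (fun α h => if_neg (by rintro ⟨i, rfl⟩; simp at h))
    (fun s α => by rw [embDomain_eq_single_iff])

/-- The multiset of the nonzero exponents of the monomial `x ^ α`. -/
def exponents (α : ℕ →₀ ℕ) : Multiset ℕ := α.support.val.map α

theorem exponents_embDomain (s : Equiv.Perm ℕ) (α : ℕ →₀ ℕ) :
    exponents (α.embDomain s.toEmbedding) = exponents α := by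
  unfold exponents
  rw [Finsupp.support_embDomain, Finset.map_val, Multiset.map_map]
  refine Multiset.map_congr rfl fun i _ => ?_
  exact Finsupp.embDomain_apply_self _ _ _

/-- The monomial symmetric function `m_μ` of a partition `μ` (a finite multiset of positive
integers): the sum of all distinct monomials whose nonzero exponents are the parts of `μ`. -/
def m (μ : Multiset ℕ+) : SymFun :=
  SymFun.mk (fun α => if exponents α = μ.map (fun i : ℕ+ => (i : ℕ)) then 1 else 0)
    (μ.map (fun i : ℕ+ => (i : ℕ))).sum
    (fun α h => if_neg fun h' => by
      rw [← h'] at h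
      exact lt_irrefl _ h)
    (fun s α => by rw [exponents_embDomain])

/-- `e_μ = ∏ e_{μ_i}`. -/
def ePart (μ : Multiset ℕ+) : SymFun := (μ.map (fun i : ℕ+ => e (i : ℕ))).prod

/-! ### The fundamental theorem: the `e_i`, `i ≥ 1`, freely generate `Λ` -/

/-- The homomorphism from the polynomial ring in the variables `X_1, X_2, …` to `Λ` sending `X_i`
to `e_i`. -/
def eHom : MvPolynomial ℕ+ ℝ →ₐ[ℝ] SymFun := MvPolynomial.aeval fun i => e (i : ℕ)

theorem coeff_e (k : ℕ) (α : ℕ →₀ ℕ) [Decidable (α.degree = k ∧ ∀ i, α i ≤ 1)] :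
    MvPowerSeries.coeff α (e k : MvPowerSeries ℕ ℝ) =
      if α.degree = k ∧ ∀ i, α i ≤ 1 then 1 else 0 := by
  rw [e, coeff_mk]
  congr

theorem coeff_esymm {n : ℕ} (k : ℕ) (α : Fin n →₀ ℕ) [Decidable (α.degree = k ∧ ∀ i, α i ≤ 1)] :
    MvPolynomial.coeff α (esymm (Fin n) ℝ k) =
      if α.degree = k ∧ ∀ i, α i ≤ 1 then 1 else 0 := by
  classical
  rw [MvPolynomial.esymm_eq_sum_monomial, MvPolynomial.coeff_sum]
  simp only [MvPolynomial.coeff_monomial]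
  have key : ∀ (t : Finset (Fin n)) (i : Fin n),
      (∑ j ∈ t, Finsupp.single j 1 : Fin n →₀ ℕ) i = if i ∈ t then 1 else 0 := by
    intro t i
    simp [Finsupp.finsetSum_apply, Finsupp.single_apply]
  have hdeg : ∀ (t : Finset (Fin n)),
      (∑ j ∈ t, Finsupp.single j 1 : Fin n →₀ ℕ).degree = t.card := by
    intro t
    simp [map_sum]
  split_ifs with h
  · have hα : (∑ j ∈ α.support, Finsupp.single j 1 : Fin n →₀ ℕ) = α := by
      ext i
      rw [key]
      have := h.2 i
      split_ifs with hi
      · rw [Finsupp.mem_support_iff] at hi; omega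
      · rw [Finsupp.notMem_support_iff] at hi; omega
    rw [Finset.sum_eq_single α.support]
    · rw [if_pos hα]
    · intro t _ ht
      refine if_neg fun h' => ht ?_
      ext i
      rw [Finsupp.mem_support_iff, ← h', key]
      simp
    · intro hn
      exfalso
      apply hn
      rw [Finset.mem_powersetCard_univ, ← hdeg, hα, h.1]
  · refine Finset.sum_eq_zero fun t ht => if_neg fun h' => h ?_
    rw [Finset.mem_powersetCard_univ] at ht
    subst h'
    refine ⟨by rw [hdeg, ht], fun i => ?_⟩
    rw [key]
    split_ifs <;> simp

/-- Restriction of a power series to the first `n` variables. -/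
def restr (n : ℕ) : MvPowerSeries ℕ ℝ →ₐ[ℝ] MvPowerSeries (Fin n) ℝ :=
  MvPowerSeries.killCompl Fin.valEmbedding

theorem coeff_restr (n : ℕ) (f : MvPowerSeries ℕ ℝ) (α : Fin n →₀ ℕ) :
    MvPowerSeries.coeff α (restr n f) =
      MvPowerSeries.coeff (α.embDomain Fin.valEmbedding) f :=
  MvPowerSeries.coeff_killCompl _ _

theorem restr_e (n k : ℕ) :
    restr n (e k : MvPowerSeries ℕ ℝ) = (esymm (Fin n) ℝ k : MvPowerSeries (Fin n) ℝ) := by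
  classical
  ext α
  rw [coeff_restr, coeff_e, MvPolynomial.coeff_coe, coeff_esymm, degree_embDomain]
  congr 2
  apply propext
  constructor
  · intro h i
    have := h (Fin.valEmbedding i)
    rwa [Finsupp.embDomain_apply_self] at this
  · intro h i
    by_cases hi : i ∈ Set.range (Fin.valEmbedding : Fin n ↪ ℕ)
    · obtain ⟨j, rfl⟩ := hi
      rw [Finsupp.embDomain_apply_self]
      exact h j
    · rw [Finsupp.embDomain_of_notMem_range _ _ _ hi]
      exact zero_le_one

/-- The index shift `i ↦ i + 1`. -/
def shift (n : ℕ) (i : Fin n) : ℕ+ := Nat.succPNat i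

theorem shift_injective (n : ℕ) : Function.Injective (shift n) := fun _ _ h =>
  Fin.ext (Nat.succPNat_injective h)

theorem restr_eHom_rename (n : ℕ) (Q : MvPolynomial (Fin n) ℝ) :
    restr n (eHom (MvPolynomial.rename (shift n) Q) : MvPowerSeries ℕ ℝ) =
      ((esymmAlgHom (Fin n) ℝ n Q : MvPolynomial (Fin n) ℝ) : MvPowerSeries (Fin n) ℝ) := by
  have : ((restr n).comp SymFun.val).comp (eHom.comp (MvPolynomial.rename (shift n))) =
      ((MvPolynomial.coeToMvPowerSeries.algHom ℝ).comp
        (MvPolynomial.symmetricSubalgebra (Fin n) ℝ).val).comp (esymmAlgHom (Fin n) ℝ n) := by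
    refine MvPolynomial.algHom_ext fun i => ?_
    simp only [AlgHom.comp_apply, MvPolynomial.rename_X, eHom, MvPolynomial.aeval_X, esymmAlgHom]
    exact (restr_e n _).trans (by simp [shift, MvPolynomial.coeToMvPowerSeries.algHom_apply])
  have h := AlgHom.congr_fun this Q
  simpa [AlgHom.comp_apply, MvPolynomial.coeToMvPowerSeries.algHom_apply] using h

theorem eHom_injective : Function.Injective eHom := by
  rw [injective_iff_map_eq_zero]
  intro P hP
  obtain ⟨n, hn⟩ : ∃ n : ℕ, ∀ i ∈ P.vars, (i : ℕ) ≤ n :=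
    ⟨P.vars.sup (fun i => (i : ℕ)), fun i hi => Finset.le_sup (f := fun i : ℕ+ => (i : ℕ)) hi⟩
  obtain ⟨Q, rfl⟩ := MvPolynomial.exists_rename_eq_of_vars_subset_range P (shift n)
    (shift_injective n) (fun i hi => by
      have h1 := hn i hi
      have h2 := i.pos
      refine ⟨⟨(i : ℕ) - 1, by omega⟩, PNat.eq ?_⟩
      simp only [shift, Nat.succPNat_coe, Nat.succ_eq_add_one]
      omega)
  have h := restr_eHom_rename n Q
  rw [hP, ZeroMemClass.coe_zero, map_zero] at h
  have h2 : esymmAlgHom (Fin n) ℝ n Q = 0 := by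
    apply Subtype.ext
    apply MvPolynomial.coe_injective
    rw [← h, ZeroMemClass.coe_zero, MvPolynomial.coe_zero]
  have h3 : Q = 0 := MvPolynomial.esymmAlgHom_injective (σ := Fin n) ℝ (Fintype.card_fin n).ge (by rw [h2, map_zero])
  rw [h3, map_zero]

theorem isHomogeneous_e (k : ℕ) : (e k : MvPowerSeries ℕ ℝ).IsHomogeneous k := by
  classical
  intro α h
  rw [coeff_e] at h
  refine (congrArg (fun g => g α) Finsupp.degree_eq_weight_one.symm).trans ?_
  by_contra hne
  exact h (if_neg fun h' => hne h'.1)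

/-- Every symmetric function of degree at most `n` that vanishes on the first `n` variables is
zero. -/
theorem eq_zero_of_restr_eq_zero (n : ℕ) (f : SymFun)
    (hd : ∀ α : ℕ →₀ ℕ, n < α.degree → MvPowerSeries.coeff α (f : MvPowerSeries ℕ ℝ) = 0)
    (hf : restr n f = 0) : f = 0 := by
  apply Subtype.ext
  ext α
  rw [ZeroMemClass.coe_zero, MvPowerSeries.coeff_zero]
  rcases lt_or_ge n α.degree with h | h
  · exact hd α h
  have hcard : α.support.card ≤ n := by
    refine le_trans ?_ h
    rw [Finsupp.degree_apply, Finset.card_eq_sum_ones]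
    refine Finset.sum_le_sum fun i hi => ?_
    rw [Finsupp.mem_support_iff] at hi
    omega
  obtain ⟨s, hs⟩ : ∃ s : Equiv.Perm ℕ, ∀ i ∈ α.support, s i < n := by
    have e1 : α.support ≃ {i : ℕ // i < α.support.card} :=
      α.support.equivFin.trans Fin.equivSubtype
    have : Finite {i : ℕ // i ∈ α.support} := inferInstanceAs (Finite α.support)
    refine ⟨Equiv.extendSubtype (p := fun i => i ∈ α.support)
      (q := fun i => i < α.support.card) e1, fun i hi => ?_⟩
    exact lt_of_lt_of_le (Equiv.extendSubtype_mem e1 i hi) hcard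
  rw [← (rename_eq_self_iff s _).1 (f.2.2 s) α]
  have hr : α.embDomain s.toEmbedding ∈
      Set.range (Finsupp.embDomain (M := ℕ) (Fin.valEmbedding : Fin n ↪ ℕ)) := by
    rw [Finsupp.mem_range_embDomain_iff]
    intro i hi
    rw [Finsupp.support_embDomain, Finset.mem_coe, Finset.mem_map] at hi
    obtain ⟨j, hj, rfl⟩ := hi
    exact ⟨⟨s j, hs j hj⟩, rfl⟩
  obtain ⟨β, hβ⟩ := hr
  rw [← hβ, ← coeff_restr, hf, MvPowerSeries.coeff_zero]

theorem isHomogeneous_ePart (s : Multiset ℕ+) :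
    (ePart s : MvPowerSeries ℕ ℝ).IsHomogeneous (s.map (fun i : ℕ+ => (i : ℕ))).sum := by
  induction s using Multiset.induction_on with
  | empty =>
    classical
    intro α h
    simp only [ePart, Multiset.map_zero, Multiset.prod_zero, OneMemClass.coe_one,
      MvPowerSeries.coeff_one] at h
    have : α = 0 := by
      by_contra hne
      exact h (if_neg hne)
    simp [this]
  | cons a s ih =>
    simp only [ePart, Multiset.map_cons, Multiset.prod_cons, Multiset.sum_cons] at ih ⊢
    exact MvPowerSeries.IsHomogeneous.mul (isHomogeneous_e _) ih

theorem eHom_monomial (μ : Multiset ℕ+) (r : ℝ) :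
    eHom (MvPolynomial.monomial (Multiset.toFinsupp μ) r) = r • ePart μ := by
  classical
  rw [eHom, MvPolynomial.aeval_monomial, ePart, Algebra.smul_def, Finsupp.prod,
    Finset.prod_multiset_map_count]
  simp

theorem eHom_surjective : Function.Surjective eHom := by
  classical
  rintro ⟨f, hf⟩
  obtain ⟨⟨n, hn⟩, hs⟩ := id hf
  -- the restriction of `f` to `n` variables is a symmetric polynomial `F`
  have hfin : ({α : Fin n →₀ ℕ | α.degree ≤ n}).Finite := by
    refine Set.Finite.subset (Set.finite_Iic (Finsupp.equivFunOnFinite.symm fun _ => n)) ?_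
    intro α hα i
    exact (Finsupp.le_degree i α).trans hα
  let F : MvPolynomial (Fin n) ℝ :=
    ∑ α ∈ hfin.toFinset, MvPolynomial.monomial α (MvPowerSeries.coeff α (restr n f))
  have hF : (F : MvPowerSeries (Fin n) ℝ) = restr n f := by
    ext α
    rw [MvPolynomial.coeff_coe, MvPolynomial.coeff_sum]
    simp only [MvPolynomial.coeff_monomial, Finset.sum_ite_eq']
    split_ifs with h
    · rfl
    · rw [coeff_restr, hn]
      rw [degree_embDomain]
      simpa using h
  have hFs : F.IsSymmetric := by
    intro s
    apply MvPolynomial.coe_injective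
    rw [← MvPowerSeries.rename_coe, hF]
    ext β
    obtain ⟨α, rfl⟩ : ∃ α : Fin n →₀ ℕ, α.embDomain s.toEmbedding = β := by
      have : β ∈ Set.range (Finsupp.embDomain (M := ℕ) s.toEmbedding) := by
        rw [Finsupp.mem_range_embDomain_iff]
        intro i _
        exact s.surjective i
      exact this
    have h1 := MvPowerSeries.coeff_embDomain_rename s.toEmbedding (restr n f) α
    refine h1.trans ?_
    rw [coeff_restr, coeff_restr,
      ← (rename_eq_self_iff (s.extendDomain Fin.equivSubtype) f).1 (hs _)]
    congr 1
    rw [Finsupp.embDomain_eq_mapDomain, Finsupp.embDomain_eq_mapDomain,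
      Finsupp.embDomain_eq_mapDomain, Finsupp.embDomain_eq_mapDomain,
      ← Finsupp.mapDomain_comp, ← Finsupp.mapDomain_comp]
    refine congrArg (fun g => MvPowerSeries.coeff (Finsupp.mapDomain g α)) ?_
    funext j
    exact Equiv.Perm.extendDomain_apply_image s Fin.equivSubtype j
  obtain ⟨Q, hQ⟩ := (MvPolynomial.esymmAlgHom_fin_bijective ℝ n).2 ⟨F, hFs⟩
  -- keep only the part of weighted degree at most `n`
  let P := MvPolynomial.rename (shift n) Q
  let wt : (ℕ+ →₀ ℕ) → ℕ := fun t =>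
    ((Multiset.toFinsupp.symm t).map (fun i : ℕ+ => (i : ℕ))).sum
  let P' : MvPolynomial ℕ+ ℝ :=
    ∑ t ∈ P.support with wt t ≤ n, MvPolynomial.monomial t (P.coeff t)
  have hmon : ∀ (t : ℕ+ →₀ ℕ) (r : ℝ) (α : ℕ →₀ ℕ), α.degree ≠ wt t →
      MvPowerSeries.coeff α (eHom (MvPolynomial.monomial t r) : MvPowerSeries ℕ ℝ) = 0 := by
    intro t r α h
    obtain ⟨μ, rfl⟩ := Multiset.toFinsupp.surjective t
    rw [eHom_monomial, SetLike.val_smul, MvPowerSeries.coeff_smul]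
    rw [MvPowerSeries.IsHomogeneous.coeff_eq_zero (isHomogeneous_ePart μ) (by simpa [wt] using h), mul_zero]
  have hcoe : ∀ (s : Finset (ℕ+ →₀ ℕ)) (α : ℕ →₀ ℕ),
      MvPowerSeries.coeff α
        (eHom (∑ t ∈ s, MvPolynomial.monomial t (P.coeff t)) : MvPowerSeries ℕ ℝ) =
      ∑ t ∈ s, MvPowerSeries.coeff α
        (eHom (MvPolynomial.monomial t (P.coeff t)) : MvPowerSeries ℕ ℝ) := by
    intro s α
    rw [map_sum, AddSubmonoidClass.coe_finsetSum, map_sum]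
  have hlow : ∀ α : ℕ →₀ ℕ, α.degree ≤ n →
      MvPowerSeries.coeff α (eHom P' : MvPowerSeries ℕ ℝ) =
      MvPowerSeries.coeff α (eHom P : MvPowerSeries ℕ ℝ) := by
    intro α hα
    conv_rhs => rw [P.as_sum]
    rw [hcoe, hcoe, Finset.sum_filter]
    refine Finset.sum_congr rfl fun t _ => ?_
    split_ifs with h
    · rfl
    · exact (hmon _ _ _ (by omega)).symm
  have hhigh : ∀ α : ℕ →₀ ℕ, n < α.degree →
      MvPowerSeries.coeff α (eHom P' : MvPowerSeries ℕ ℝ) = 0 := by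
    intro α hα
    rw [hcoe]
    refine Finset.sum_eq_zero fun t ht => hmon _ _ _ ?_
    have := (Finset.mem_filter.1 ht).2
    omega
  have hPF : restr n (eHom P : MvPowerSeries ℕ ℝ) = restr n f := by
    rw [restr_eHom_rename, hQ, hF]
  refine ⟨P', sub_eq_zero.1 (eq_zero_of_restr_eq_zero n _ (fun α hα => ?_) ?_)⟩
  · rw [AddSubgroupClass.coe_sub, map_sub, hhigh α hα, hn α hα, sub_zero]
  · ext β
    rw [AddSubgroupClass.coe_sub, map_sub, map_sub, coeff_restr, map_zero]
    rcases lt_or_ge n β.degree with h | h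
    · rw [hhigh _ (by rwa [degree_embDomain]), coeff_restr, hn _ (by rwa [degree_embDomain]),
        sub_zero]
    · rw [hlow _ (by rwa [degree_embDomain]), ← coeff_restr, hPF, sub_self]

/-- The fundamental theorem of symmetric functions: `Λ` is the polynomial ring on `e_1, e_2, …`. -/
def eEquiv : MvPolynomial ℕ+ ℝ ≃ₐ[ℝ] SymFun :=
  AlgEquiv.ofBijective eHom ⟨eHom_injective, eHom_surjective⟩

/-- The basis of `Λ` formed by the `e_μ`, where `μ` runs over all partitions. -/
def eBasis : Module.Basis (Multiset ℕ+) ℝ SymFun :=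
  ((MvPolynomial.basisMonomials ℕ+ ℝ).map eEquiv.toLinearEquiv).reindex
    Multiset.toFinsupp.symm.toEquiv

theorem eBasis_apply (μ : Multiset ℕ+) : eBasis μ = ePart μ := by
  have h : eBasis μ = eHom (MvPolynomial.monomial (Multiset.toFinsupp μ) 1) := by
    simp [eBasis, eEquiv]
    rfl
  rw [h, eHom_monomial, one_smul]

/-! ### Graphs: chromatic symmetric function, `e`-coefficients and the `G`-homomorphism -/

section Graph

variable {V : Type*} [Fintype V]

/-- The chromatic symmetric function `X_G = ∑_c ∏_v x_{c(v)}`, the sum being over all proper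
colourings `c : V → ℕ`: the coefficient of `x ^ α` is the number of proper colourings in which each
colour `i` is used exactly `α i` times. -/
def chromatic (G : SimpleGraph V) : SymFun :=
  SymFun.mk
    (fun α => (Nat.card {c : V → ℕ // (∀ u v, G.Adj u v → c u ≠ c v) ∧
      ∑ v, Finsupp.single (c v) 1 = α} : ℝ))
    (Fintype.card V)
    (fun α h => by
      rw [Nat.cast_eq_zero]
      have : IsEmpty {c : V → ℕ // (∀ u v, G.Adj u v → c u ≠ c v) ∧
          ∑ v, Finsupp.single (c v) 1 = α} := by
        refine ⟨fun c => ?_⟩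
        have h1 := c.2.2
        rw [← h1, map_sum] at h
        simp at h
      exact Nat.card_of_isEmpty)
    (fun s α => by
      have key : ∀ c : V → ℕ, ∑ v, Finsupp.single (s (c v)) 1 =
          (∑ v, Finsupp.single (c v) 1 : ℕ →₀ ℕ).embDomain s.toEmbedding := by
        intro c
        rw [Finsupp.embDomain_eq_mapDomain, Finsupp.mapDomain_finsetSum]
        simp [Finsupp.mapDomain_single]
      congr 1
      refine (Nat.card_congr ((Equiv.arrowCongr (Equiv.refl V) s).subtypeEquiv fun c => ?_)).symm
      simp only [Equiv.arrowCongr_apply, Equiv.refl_symm, Equiv.coe_refl, Function.comp_apply, id,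
        key, (Finsupp.embDomain_injective s.toEmbedding).eq_iff, ne_eq,
        s.injective.eq_iff])

/-- The coefficient `c_μ(G)` of `e_μ` in the expansion `X_G = ∑_μ c_μ(G) e_μ`. -/
def eCoeff (G : SimpleGraph V) (μ : Multiset ℕ+) : ℝ := eBasis.repr (chromatic G) μ

open Classical in
/-- The `G`-analogue `e_i^G` of `e_i`: the sum over all stable `i`-element sets `S` of vertices of
the monomials `∏_{v ∈ S} v`. -/
def eG (G : SimpleGraph V) (i : ℕ) : MvPolynomial V ℝ :=
  ∑ S ∈ {S : Finset V | S.card = i ∧ G.IsIndepSet (S : Set V)}, ∏ v ∈ S, MvPolynomial.X v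

/-- Stanley's `G`-homomorphism `f ↦ f^G`, the ring homomorphism on `Λ` extending
`e_i ↦ e_i^G`. -/
def gHom (G : SimpleGraph V) : SymFun →ₐ[ℝ] MvPolynomial V ℝ :=
  (MvPolynomial.aeval fun i : ℕ+ => eG G i).comp eEquiv.symm.toAlgHom

theorem gHom_e (G : SimpleGraph V) (i : ℕ+) : gHom G (e i) = eG G i := by
  have h : e i = eEquiv (MvPolynomial.X i) := by simp [eEquiv, eHom]
  rw [h]
  simp [gHom]

end Graph

/-! ### Unit interval orders and correct sequences -/

section Order

variable (U : Type*) [PartialOrder U]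

/-- `U` is isomorphic to a set of real numbers ordered by `u ≺ w ↔ u + 1 ≤ w`. -/
def IsUnitInterval : Prop :=
  ∃ f : U → ℝ, Function.Injective f ∧ ∀ u w : U, u < w ↔ f u + 1 ≤ f w

/-- The incomparability graph `inc(U)`. -/
def inc : SimpleGraph U where
  Adj u w := ¬ u ≤ w ∧ ¬ w ≤ u
  symm := ⟨fun _ _ h => ⟨h.2, h.1⟩⟩
  loopless := ⟨fun _ h => h.1 le_rfl⟩

variable {U}

/-- `u ∼ w`: neither `u ≺ w` nor `w ≺ u` (in particular `u ∼ u`). -/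
def Sim (u w : U) : Prop := ¬ u < w ∧ ¬ w < u

/-- Correct sequences: no `w_i ≻ w_{i+1}`, and every `w_j` but the first has some `i < j` with
`w_i ⊀ w_j`. -/
def IsCorrect {k : ℕ} (w : Fin k → U) : Prop :=
  (∀ i j : Fin k, (j : ℕ) = i + 1 → ¬ w j < w i) ∧
    ∀ j : Fin k, 0 < (j : ℕ) → ∃ i : Fin k, i < j ∧ ¬ w i < w j

/-- The first condition defining `M_{l,2}` (with sequences indexed from `0`): every term of `w`
but the last is `≺ q_0`, and the last term of `w` is `≺ q_1`. -/
def Below {l : ℕ} (w : Fin l → U) (q : Fin 2 → U) : Prop :=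
  (∀ i : Fin l, (i : ℕ) + 1 < l → w i < q 0) ∧ ∀ i : Fin l, (i : ℕ) + 1 = l → w i < q 1

/-- The second condition defining `M_{l,2}`: for `θ` the largest index with `w_θ ∼ w_{θ+1}`,
one has `w_θ ≻ q_0` and `w_{θ+1} ≻ q_1`. -/
def Above {l : ℕ} (w : Fin l → U) (q : Fin 2 → U) : Prop :=
  ∃ (t : ℕ) (ht : t + 1 < l),
    IsGreatest {i : ℕ | ∃ hi : i + 1 < l, Sim (w ⟨i, by omega⟩) (w ⟨i + 1, hi⟩)} t ∧
      q 0 < w ⟨t, by omega⟩ ∧ q 1 < w ⟨t + 1, ht⟩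

variable (U) [Fintype U]

open Classical in
/-- The set `P_{l,2}` of pairs of a correct sequence of length `l` and one of length `2`. -/
def PSet (l : ℕ) : Finset ((Fin l → U) × (Fin 2 → U)) :=
  {x | IsCorrect x.1 ∧ IsCorrect x.2}

open Classical in
/-- The subset `M_{l,2}` of `P_{l,2}`. -/
def MSet (l : ℕ) : Finset ((Fin l → U) × (Fin 2 → U)) :=
  {x ∈ PSet U l | Below x.1 x.2 ∨ Above x.1 x.2}

/-- The sum of the monomials `w_1 ⋯ w_l q_0 q_1` over `M_{l,2}`. -/
def MSum (l : ℕ) : MvPolynomial U ℝ :=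
  ∑ x ∈ MSet U l, (∏ i, MvPolynomial.X (x.1 i)) * ∏ j, MvPolynomial.X (x.2 j)

end Order

end ChromSym

end

noncomputable section

namespace ChromSym

/-! ### Correct sequences of real numbers -/

/-! The theorem is a count of words. For a unit interval order, p_n^U is the sum of the monomials of
the correct words of length n (`gHom_p`). So p_l^U p_2^U is a sum over all pairs (w|q) of correct
words, and one has to see that removing the correct words of length l + 2 leaves the pairs in M.

For `gHom_p`, let D_k be the sum of the words whose descents are exactly the first k steps, and R_k
the part of it without a record (a letter dominating all earlier ones) after position k; R_0 is the
sum of the correct words. Moving the last record to the front gives D_k = R_{k+1} + R_k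
(`descentSum_eq`), so R_0 is the alternating sum of the D_k. Let h_m be the sum of the words of
length m without descents. A decreasing word followed by a descent-free one may or may not descend
at the joint, so e_j^U h_{n-j} = D_j + D_{j-1}. With these relations, the generating function of the
h_m inverts that of (-1)^j e_j^U, and multiplying it with that of (-1)^j j e_j^U gives minus the
generating function of the correct words. Newton's identities finish.

For the main identity, take a correct word u of length l + 2 and its last index i with u_i ∼
u_{i+1}. Deleting these two letters leaves a correct w, and they form q (`valid_iff`). The one
exception is that the last letter dominates everything before u_i and i is antepenultimate; then the
last letter and u_i are taken out instead (`endValid_iff`). A fixed pair (w|q) may arise from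
several u or from none. By `count_insertions` the number of them is 1 minus the indicator of M, plus
terms that change sign when q_0 and q_1 are exchanged; those cancel in the sum because the monomial
is symmetric in q.

The statement on m_{l,2} follows since p_a p_b - p_{a+b} is m_{a,b}, or 2 m_{a,a} when a = b. For
the last claim, Stanley's formula (`chromatic_eq_sum`) gives c_μ as the coefficient of the product
of all vertices in m_μ^U. It rests on the symmetry of the matrix expanding the e_λ in the m_μ. The
sum over M has nonnegative coefficients. -/

/-- The first `n` terms of `g` form a correct sequence for the order `x + 1 ≤ y` on `ℝ`. -/
def RealCorrect (n : ℕ) (g : ℕ → ℝ) : Prop :=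
  (∀ j, j + 1 < n → g j < g (j + 1) + 1) ∧ ∀ j, 0 < j → j < n → ∃ i < j, g j < g i + 1

/-- `i` is the largest index with `g i ∼ g (i + 1)`, and the terms after it form a chain. -/
def TailAt (n : ℕ) (g : ℕ → ℝ) (i : ℕ) : Prop :=
  i + 1 < n ∧ g i < g (i + 1) + 1 ∧ g (i + 1) < g i + 1 ∧
    ∀ j, i < j → j + 1 < n → g j + 1 ≤ g (j + 1)

/-- The increasing enumeration of the natural numbers other than `i` and `i + 1`. -/
def skip (i j : ℕ) : ℕ := if j < i then j else j + 2

theorem skip_of_lt {i j : ℕ} (h : j < i) : skip i j = j := if_pos h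

theorem skip_of_le {i j : ℕ} (h : i ≤ j) : skip i j = j + 2 := if_neg (by omega)

/-- Inserting `a, b` at position `i` into `w` gives a correct sequence with `TailAt` index `i`. -/
def Valid (l : ℕ) (w : ℕ → ℝ) (a b : ℝ) (i : ℕ) : Prop :=
  1 ≤ i ∧ i ≤ l ∧ (∀ j, i ≤ j → j + 1 < l → w j + 1 ≤ w (j + 1)) ∧ w (i - 1) < a + 1 ∧
    (∃ j < i, a < w j + 1) ∧ (i < l → b + 1 ≤ w i)

/-- Inserting `b` before and `a` after the last term of `w` gives a correct sequence whose last
term dominates everything but `b`. -/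
def EndValid (l : ℕ) (w : ℕ → ℝ) (a b : ℝ) : Prop :=
  (∀ j < l, w j + 1 ≤ a) ∧ (b < w (l - 1) + 1 ∧ w (l - 1) < b + 1) ∧ ∃ j < l - 1, b < w j + 1

theorem chain_lt {n i : ℕ} {g : ℕ → ℝ} (h : ∀ j, i < j → j + 1 < n → g j + 1 ≤ g (j + 1))
    {j k : ℕ} (hij : i < j) (hjk : j < k) (hk : k < n) : g j + 1 ≤ g k := by
  induction k, hjk using Nat.le_induction with
  | base => exact h j hij hk
  | succ k hk' ih =>
    have h1 := ih (by omega)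
    have h2 := h k (by omega) hk
    linarith

theorem exists_tailAt {n : ℕ} {g : ℕ → ℝ} (hn : 2 ≤ n) (hg : RealCorrect n g) :
    ∃ i, TailAt n g i := by
  classical
  have h0 : g 1 < g 0 + 1 := by
    obtain ⟨i, hi, h⟩ := hg.2 1 one_pos (by omega)
    obtain rfl : i = 0 := by omega
    exact h
  let Q : ℕ → Prop := fun i => i + 1 < n ∧ g (i + 1) < g i + 1
  have hQ : Q (Nat.findGreatest Q n) := Nat.findGreatest_spec (P := Q) (m := 0) (by omega) ⟨hn, h0⟩
  refine ⟨_, hQ.1, hg.1 _ hQ.1, hQ.2, fun j hj hjn => ?_⟩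
  by_contra hlt
  exact Nat.findGreatest_is_greatest (P := Q) hj (by omega) ⟨hjn, not_le.1 hlt⟩

theorem TailAt.unique {n i k : ℕ} {g : ℕ → ℝ} (hi : TailAt n g i) (hk : TailAt n g k) : i = k := by
  obtain ⟨h1, h2, h3, h4⟩ := hi
  obtain ⟨k1, k2, k3, k4⟩ := hk
  rcases lt_trichotomy i k with h | h | h
  · have := h4 k h k1
    linarith
  · exact h
  · have := k4 i h h1
    linarith

/-- Deleting the pair at i can harm correctness only by removing the witness that a later term is
not a record. Terms of the final chain are too far above g i and g (i + 1) to use them as witnesses,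
except for the first one, g (i + 2). If the chain goes on, that one inherits a witness from its
successor; if not, the negated condition supplies it. -/
theorem valid_iff {l i : ℕ} (hl : 2 ≤ l) (g : ℕ → ℝ) :
    (RealCorrect (l + 2) g ∧ TailAt (l + 2) g i ∧ ¬ (i + 1 = l ∧ ∀ j < i, g j + 1 ≤ g (l + 1))) ↔
      RealCorrect l (fun j => g (skip i j)) ∧ (g i < g (i + 1) + 1 ∧ g (i + 1) < g i + 1) ∧
        Valid l (fun j => g (skip i j)) (g i) (g (i + 1)) i := by
  constructor
  · rintro ⟨⟨c1, c2⟩, ⟨t1, t2, t3, t4⟩, hF⟩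
    have hc := fun {j k : ℕ} => chain_lt t4 (j := j) (k := k)
    -- For i = 0 the chain g 1, g 2, g 3 rises by 2 from above g 0 - 1, so g 3 would dominate all
    -- earlier terms; index 3 exists because 2 ≤ l.
    have hi : 1 ≤ i := by
      by_contra h
      obtain rfl : i = 0 := by omega
      obtain ⟨k, hk, h⟩ := c2 3 (by omega) (by omega)
      have h12 := t4 1 (by omega) (by omega)
      have h23 := t4 2 (by omega) (by omega)
      simp only [zero_add] at t2 t3
      norm_num at h12 h23
      interval_cases k <;> linarith
    -- a later term dominated by an earlier one is dominated by one of the first `i + 1`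
    have key : ∀ j, i ≤ j → j < l → ∃ k ≤ i, g (j + 2) < g k + 1 := by
      intro j hj hjl
      obtain ⟨k, hk, h⟩ := c2 (j + 2) (by omega) (by omega)
      refine ⟨k, ?_, h⟩
      by_contra hki
      have := hc (not_le.1 hki) hk (by omega)
      linarith
    -- The witness cannot be i: g (j + 2) is at least two chain steps above g (i + 1), hence more
    -- than 1 above g i.
    have key2 : ∀ j, i < j → j < l → ∃ k < i, g (j + 2) < g k + 1 := by
      intro j hj hjl
      obtain ⟨k, hk, h⟩ := key j hj.le hjl
      refine ⟨k, lt_of_le_of_ne hk ?_, h⟩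
      rintro rfl
      have h1 := hc (j := k + 1) (k := k + 2) (by omega) (by omega) (by omega)
      have h2 := hc (j := k + 2) (k := j + 2) (by omega) (by omega) (by omega)
      linarith
    -- For j = i a witness for the next chain term serves as well, the present term being smaller;
    -- without a next term, the absence of a witness is the excluded case.
    have key3 : ∀ j, i ≤ j → j < l → ∃ k < i, g (j + 2) < g k + 1 := by
      intro j hj hjl
      rcases hj.lt_or_eq with h | rfl
      · exact key2 j h hjl
      by_cases hl' : i + 1 = l
      · by_contra hno
        push Not at hno
        refine hF ⟨hl', fun j hj => ?_⟩
        have := hno j hj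
        rwa [show l + 1 = i + 2 by omega]
      · obtain ⟨k, hk, h⟩ := key2 (i + 1) (by omega) (by omega)
        have := hc (j := i + 2) (k := i + 1 + 2) (by omega) (by omega) (by omega)
        exact ⟨k, hk, by linarith⟩
    refine ⟨⟨fun j hj => ?_, fun j hj0 hj => ?_⟩, ⟨t2, t3⟩, hi, by omega, fun j hj hjl => ?_, ?_, ?_,
      fun h => ?_⟩
    · dsimp only
      rcases lt_trichotomy (j + 1) i with h | h | h
      · rw [skip_of_lt h, skip_of_lt (by omega)]
        exact c1 j (by omega)
      · rw [skip_of_le h.ge, skip_of_lt (by omega)]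
        have h1 := c1 j (by omega)
        have h2 := t4 (i + 1) (by omega) (by omega)
        rw [h] at h1 ⊢
        linarith
      · rw [skip_of_le (by omega), skip_of_le (by omega)]
        exact c1 (j + 2) (by omega)
    · dsimp only
      rcases lt_or_ge j i with h | h
      · obtain ⟨k, hk, h'⟩ := c2 j hj0 (by omega)
        exact ⟨k, hk, by rwa [skip_of_lt h, skip_of_lt (by omega)]⟩
      · obtain ⟨k, hk, h'⟩ := key3 j h hj
        exact ⟨k, by omega, by rwa [skip_of_le h, skip_of_lt hk]⟩
    · dsimp only
      rw [skip_of_le hj, skip_of_le (by omega)]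
      exact t4 (j + 2) (by omega) (by omega)
    · dsimp only
      rw [skip_of_lt (by omega)]
      have := c1 (i - 1) (by omega)
      rwa [Nat.sub_add_cancel hi] at this
    · obtain ⟨k, hk, h⟩ := c2 i hi (by omega)
      exact ⟨k, hk, by dsimp only; rwa [skip_of_lt hk]⟩
    · dsimp only
      rw [skip_of_le le_rfl]
      exact t4 (i + 1) (by omega) (by omega)
  · rintro ⟨⟨c1, c2⟩, ⟨t2, t3⟩, hi, hil, v1, v2, ⟨k, hk, v3⟩, v4⟩
    dsimp only at *
    refine ⟨⟨fun j hj => ?_, fun j hj0 hj => ?_⟩, ⟨by omega, t2, t3, fun j hj hjl => ?_⟩, ?_⟩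
    · rcases lt_trichotomy (j + 1) i with h | h | h
      · have := c1 j (by omega)
        rwa [skip_of_lt h, skip_of_lt (by omega)] at this
      · rw [skip_of_lt (by omega)] at v2
        rwa [h, show j = i - 1 by omega]
      · obtain h | h | h : j = i ∨ j = i + 1 ∨ i + 2 ≤ j := by omega
        · rwa [h]
        · have := v4 (by omega)
          rw [skip_of_le le_rfl] at this
          rw [h]
          linarith
        · have := c1 (j - 2) (by omega)
          rwa [skip_of_le (by omega), skip_of_le (by omega), show j - 2 + 2 = j by omega,
            show j - 2 + 1 + 2 = j + 1 by omega] at this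
    · obtain h | h | h | h : j < i ∨ j = i ∨ j = i + 1 ∨ i + 2 ≤ j := by omega
      · obtain ⟨k, hk, h'⟩ := c2 j hj0 (by omega)
        rw [skip_of_lt h, skip_of_lt (by omega)] at h'
        exact ⟨k, hk, h'⟩
      · rw [skip_of_lt hk] at v3
        exact ⟨k, by omega, by rwa [h]⟩
      · exact ⟨i, by omega, by rwa [h]⟩
      · obtain ⟨k, hk, h'⟩ := c2 (j - 2) (by omega) (by omega)
        rw [skip_of_le (by omega), show j - 2 + 2 = j by omega] at h'
        refine ⟨skip i k, ?_, h'⟩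
        unfold skip
        split_ifs <;> omega
    · obtain h | h : j = i + 1 ∨ i + 2 ≤ j := by omega
      · have := v4 (by omega)
        rw [skip_of_le le_rfl] at this
        rwa [h]
      · have := v1 (j - 2) (by omega) (by omega)
        rwa [skip_of_le (by omega), skip_of_le (by omega), show j - 2 + 2 = j by omega,
            show j - 2 + 1 + 2 = j + 1 by omega] at this
    · rintro ⟨h1, h2⟩
      obtain ⟨k, hk, h'⟩ := c2 i hi (by omega)
      rw [skip_of_le le_rfl, skip_of_lt hk, show i + 2 = l + 1 by omega] at h'
      have := h2 k hk
      linarith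

/-- The exceptional words. Here deleting the pair at l - 1 would leave the last letter as a record,
so that letter and the one at l - 1 are taken out, in this order, and the letter at l becomes the
end of `w`. -/
theorem endValid_iff {l : ℕ} (hl : 2 ≤ l) (g w : ℕ → ℝ) (hw : ∀ j < l - 1, w j = g j)
    (hw' : w (l - 1) = g l) :
    (RealCorrect (l + 2) g ∧ TailAt (l + 2) g (l - 1) ∧ ∀ j < l - 1, g j + 1 ≤ g (l + 1)) ↔
      RealCorrect l w ∧ (g (l + 1) < g (l - 1) + 1 ∧ g (l - 1) < g (l + 1) + 1) ∧
        EndValid l w (g (l + 1)) (g (l - 1)) := by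
  have hll : l - 1 + 1 = l := by omega
  constructor
  · rintro ⟨⟨c1, c2⟩, ⟨t1, t2, t3, t4⟩, hF⟩
    rw [hll] at t2 t3
    have h1 := t4 l (by omega) (by omega)
    -- The last letter is not a record, and every earlier position other than l - 1 is known to be
    -- dominated by it.
    have h2 : g (l + 1) < g (l - 1) + 1 := by
      obtain ⟨k, hk, h⟩ := c2 (l + 1) (by omega) (by omega)
      obtain hk | hk | hk : k < l - 1 ∨ k = l - 1 ∨ k = l := by omega
      · have := hF k hk
        linarith
      · rwa [← hk]
      · rw [hk] at h
        linarith
    obtain ⟨k, hk, h3⟩ := c2 (l - 1) (by omega) (by omega)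
    refine ⟨⟨fun j hj => ?_, fun j hj0 hj => ?_⟩, ⟨h2, by linarith⟩, fun j hj => ?_, ?_, ?_⟩
    · rw [hw j (by omega)]
      obtain h | h : j + 1 < l - 1 ∨ j + 1 = l - 1 := by omega
      · rw [hw _ h]
        exact c1 j (by omega)
      · rw [h, hw']
        have := hF j (by omega)
        linarith
    · obtain h | h : j < l - 1 ∨ j = l - 1 := by omega
      · obtain ⟨k, hk, h'⟩ := c2 j hj0 (by omega)
        exact ⟨k, hk, by rwa [hw _ h, hw _ (by omega)]⟩
      · refine ⟨k, by omega, ?_⟩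
        rw [h, hw', hw _ hk]
        linarith
    · obtain h | h : j < l - 1 ∨ j = l - 1 := by omega
      · rw [hw _ h]
        exact hF _ h
      · rwa [h, hw']
    · rw [hw']
      exact ⟨t2, t3⟩
    · exact ⟨k, hk, by rwa [hw _ hk]⟩
  · rintro ⟨⟨c1, c2⟩, ⟨h1, h2⟩, e1, ⟨e2, e3⟩, k, hk, e4⟩
    have ew := e1 (l - 1) (by omega)
    rw [hw'] at e2 e3 ew
    have hF : ∀ j < l - 1, g j + 1 ≤ g (l + 1) := fun j hj => by
      rw [← hw _ hj]
      exact e1 j (by omega)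
    refine ⟨⟨fun j hj => ?_, fun j hj0 hj => ?_⟩, ⟨by omega, ?_, ?_, fun j hj hjl => ?_⟩, hF⟩
    · obtain h | h | h | h : j + 1 < l - 1 ∨ j + 1 = l - 1 ∨ j = l - 1 ∨ j = l := by omega
      · rw [← hw _ h, ← hw j (by omega)]
        exact c1 j (by omega)
      · rw [h]
        have := hF j (by omega)
        linarith
      · rwa [h, hll]
      · rw [h]
        linarith
    · obtain h | h | h | h : j < l - 1 ∨ j = l - 1 ∨ j = l ∨ j = l + 1 := by omega
      · obtain ⟨k, hk, h'⟩ := c2 j hj0 (by omega)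
        exact ⟨k, hk, by rwa [← hw _ h, ← hw _ (by omega)]⟩
      · exact ⟨k, by omega, by rwa [h, ← hw _ hk]⟩
      · exact ⟨l - 1, by omega, by rwa [h]⟩
      · exact ⟨l - 1, by omega, by rwa [h]⟩
    · rwa [hll]
    · rwa [hll]
    · obtain rfl : j = l := by omega
      exact ew

/-! ### Counting the insertions of a pair into a fixed word -/

/-- All terms of `w` but the last are dominated by `a`, and the last one by `b`. -/
def RealBelow (l : ℕ) (w : ℕ → ℝ) (a b : ℝ) : Prop :=
  (∀ j < l - 1, w j + 1 ≤ a) ∧ w (l - 1) + 1 ≤ b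

/-- `w θ` dominates `a` and `w (θ + 1)` dominates `b`. -/
def RealAbove (θ : ℕ) (w : ℕ → ℝ) (a b : ℝ) : Prop := a + 1 ≤ w θ ∧ b + 1 ≤ w (θ + 1)

/-- Some term of the final chain of `w` dominates `a` and is incomparable to `b`. -/
def Between (l θ : ℕ) (w : ℕ → ℝ) (a b : ℝ) : Prop :=
  ∃ k, θ < k ∧ k < l ∧ a + 1 ≤ w k ∧ b < w k + 1 ∧ w k < b + 1

/-- `a` dominates all terms of `w` but the last; it is incomparable to the last one, which is
dominated by `b`. -/
def Crossing (l : ℕ) (w : ℕ → ℝ) (a b : ℝ) : Prop :=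
  (∀ j < l - 1, w j + 1 ≤ a) ∧ (a < w (l - 1) + 1 ∧ w (l - 1) < a + 1) ∧ w (l - 1) + 1 ≤ b

/-- Let k be the first chain index whose term dominates a. Earlier terms do not dominate a, and
later ones are at least a + 2 > b + 1, so `w k` is the only possible witness. -/
theorem between_iff {l θ k : ℕ} {w : ℕ → ℝ} {a b : ℝ} (hθ : TailAt l w θ) (hba : b < a + 1)
    (hk : θ < k) (hkl : k < l) (h1 : ∀ j, θ < j → j < k → w j < a + 1) (h2 : a + 1 ≤ w k) :
    Between l θ w a b ↔ w k < b + 1 := by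
  constructor
  · rintro ⟨k', hk', hkl', h3, h4, h5⟩
    have : k ≤ k' := by
      by_contra h
      have := h1 k' hk' (by omega)
      linarith
    rcases this.lt_or_eq with h | rfl
    · have := chain_lt hθ.2.2.2 hk h hkl'
      linarith
    · exact h5
  · intro h
    exact ⟨k, hk, hkl, h2, by linarith, h⟩

/-- With a and b exchanged, a witness must come before k. If it came before k - 1, then `w (k - 1)`
would be at least b + 2 and so dominate a. The value k = l stands for a chain in which no term
dominates a. -/
theorem between_swap_iff {l θ k : ℕ} {w : ℕ → ℝ} {a b : ℝ} (hθ : TailAt l w θ) (hab : a < b + 1)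
    (hk : θ < k) (hkl : k ≤ l) (h1 : ∀ j, θ < j → j < k → w j < a + 1)
    (h2 : k < l → a + 1 ≤ w k) :
    Between l θ w b a ↔ θ + 2 ≤ k ∧ b + 1 ≤ w (k - 1) := by
  constructor
  · rintro ⟨k', hk', hkl', h3, h4, h5⟩
    have hlt : k' < k := by
      by_contra h
      have h6 := h2 (by omega)
      rcases (not_lt.1 h).lt_or_eq with h | rfl
      · have := chain_lt hθ.2.2.2 hk h hkl'
        linarith
      · linarith
    obtain h | rfl : k' < k - 1 ∨ k' = k - 1 := by omega
    · have h6 := chain_lt hθ.2.2.2 hk' h (by omega)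
      have h7 := h1 (k - 1) (by omega) (by omega)
      linarith
    · exact ⟨by omega, h3⟩
  · rintro ⟨h3, h4⟩
    exact ⟨k - 1, by omega, by omega, h4, by linarith, h1 _ (by omega) (by omega)⟩

section Count

variable {l θ k : ℕ} {w : ℕ → ℝ} {a b : ℝ}

/-- Only two positions can be valid. -/
theorem Valid.eq_or (hθ : TailAt l w θ) (hab : a < b + 1) (hk : θ < k) (hkl : k ≤ l)
    (h1 : ∀ j, θ < j → j < k → w j < a + 1) (h2 : k < l → a + 1 ≤ w k) {i : ℕ}
    (hi : Valid l w a b i) : θ < i ∧ (i = k ∨ i = k - 1) := by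
  obtain ⟨i1, i2, i3, i4, -, i6⟩ := hi
  have hi : θ < i := by
    by_contra h
    have h3 := i3 θ (not_lt.1 h) hθ.1
    have h4 := hθ.2.2.1
    linarith
  refine ⟨hi, ?_⟩
  have hik : i ≤ k := by
    by_contra h
    have h3 := h2 (by omega)
    obtain h | h : k = i - 1 ∨ k < i - 1 := by omega
    · rw [h] at h3
      linarith
    · have := chain_lt hθ.2.2.2 hk h (by omega)
      linarith
  by_contra h
  have h3 := i6 (by omega)
  have h4 := chain_lt hθ.2.2.2 (j := i) (k := k - 1) hi (by omega) (by omega)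
  have h5 := h1 (k - 1) (by omega) (by omega)
  linarith

open Classical in
theorem sum_valid (hθ : TailAt l w θ) (hab : a < b + 1) (hk : θ < k) (hkl : k ≤ l)
    (h1 : ∀ j, θ < j → j < k → w j < a + 1) (h2 : k < l → a + 1 ≤ w k) :
    ∑ i ∈ Finset.range (l + 1), (if Valid l w a b i then 1 else 0) =
      (if Valid l w a b k then 1 else 0) + if Valid l w a b (k - 1) then 1 else 0 := by
  refine Finset.sum_eq_add k (k - 1) (by omega) (fun i _ hi => if_neg fun h => ?_)
    (fun h => ?_) (fun h => ?_)
  · rcases (h.eq_or hθ hab hk hkl h1 h2).2 with h | h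
    exacts [hi.1 h, hi.2 h]
  · rw [Finset.mem_range] at h
    omega
  · rw [Finset.mem_range] at h
    omega

/-- The only requirement in doubt is that inserting a after `w (k - 2)` makes no descent. This can
fail only for k - 2 = θ, and its failure is then the first half of `RealAbove`, the second half
being `h4`. For larger k, `RealAbove` would put `w (k - 1)` above a + 1. -/
theorem valid_pred_iff (hw : RealCorrect l w) (hθ : TailAt l w θ) (hab : a < b + 1)
    (hkl : k ≤ l) (h1 : ∀ j, θ < j → j < k → w j < a + 1)
    (h3 : θ + 2 ≤ k) (h4 : b + 1 ≤ w (k - 1)) :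
    Valid l w a b (k - 1) ↔ ¬ RealAbove θ w a b := by
  obtain ⟨t1, t2, t3, t4⟩ := id hθ
  constructor
  · rintro h ⟨h5, h6⟩
    obtain h7 | h7 : k = θ + 2 ∨ θ + 1 < k - 1 := by omega
    · have h8 := h.2.2.2.1
      rw [show k - 1 - 1 = θ by omega] at h8
      linarith
    · have := chain_lt t4 (j := θ + 1) (by omega) h7 (by omega)
      have := h1 (k - 1) (by omega) (by omega)
      linarith
  · intro h
    refine ⟨by omega, by omega, fun j hj hjl => t4 j (by omega) hjl, ?_, ?_, fun _ => h4⟩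
    · obtain h7 | h7 : k - 1 - 1 = θ ∨ θ < k - 1 - 1 := by omega
      · rw [h7]
        by_contra h8
        rw [show k - 1 = θ + 1 by omega] at h4
        exact h ⟨not_lt.1 h8, h4⟩
      · exact h1 _ h7 (by omega)
    · obtain ⟨j, hj, h5⟩ := hw.2 (k - 1) (by omega) (by omega)
      exact ⟨j, hj, by linarith⟩

open Classical in
theorem count_of_lt (hw : RealCorrect l w) (hθ : TailAt l w θ) (hab : a < b + 1) (hba : b < a + 1)
    (hk : θ < k) (hkl : k < l) (h1 : ∀ j, θ < j → j < k → w j < a + 1) (h2 : a + 1 ≤ w k) :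
    (∑ i ∈ Finset.range (l + 1), if Valid l w a b i then 1 else 0) +
      (if EndValid l w a b then 1 else 0) +
      (if RealBelow l w a b ∨ RealAbove θ w a b then 1 else 0) +
      (if Between l θ w a b then 1 else 0) + (if Crossing l w b a then 1 else 0) =
    1 + (if Between l θ w b a then 1 else 0) + if Crossing l w a b then 1 else 0 := by
  obtain ⟨t1, t2, t3, t4⟩ := id hθ
  -- The chain ends at or above a + 1 > b, so all conditions making the last term incomparable to a,
  -- or dominated by a or b, fail.
  have hlast : w k ≤ w (l - 1) := by
    obtain h | h : k = l - 1 ∨ k < l - 1 := by omega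
    · rw [h]
    · have := chain_lt t4 hk h (by omega)
      linarith
  have n1 : ¬ EndValid l w a b := fun h => by
    have := h.1 k hkl
    linarith
  have n2 : ¬ RealBelow l w a b := fun h => by
    have := h.2
    linarith
  have n3 : ¬ Crossing l w a b := fun h => by
    have := h.2.1.2
    linarith
  have n4 : ¬ Crossing l w b a := fun h => by
    have := h.2.2
    linarith
  rw [sum_valid hθ hab hk hkl.le h1 fun _ => h2, if_neg n1, if_neg n3, if_neg n4]
  simp only [n2, false_or, between_iff hθ hba hk hkl h1 h2,
    between_swap_iff hθ hab hk hkl.le h1 fun _ => h2]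
  -- If `w k` is incomparable to b, no insertion is possible, and `Between l θ w a b` is the one
  -- nonzero term on the left.
  by_cases c1 : w k < b + 1
  · have m1 : ¬ Valid l w a b k := fun h => by
      have := h.2.2.2.2.2 hkl
      linarith
    have m3 : ¬ (θ + 2 ≤ k ∧ b + 1 ≤ w (k - 1)) := fun h => by
      have := chain_lt t4 (j := k - 1) (k := k) (by omega) (by omega) hkl
      linarith [h.2]
    have m2 : ¬ Valid l w a b (k - 1) := fun h => by
      have h3 := (h.eq_or hθ hab hk hkl.le h1 fun _ => h2).1
      exact m3 ⟨by omega, h.2.2.2.2.2 (by omega)⟩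
    have m4 : ¬ RealAbove θ w a b := fun h => by
      obtain h3 | h3 : k = θ + 1 ∨ θ + 1 < k := by omega
      · rw [h3] at c1
        linarith [h.2]
      · have := chain_lt t4 (by omega) h3 hkl
        linarith [h.2]
    simp only [if_neg m1, if_neg m2, if_neg m3, if_neg m4, if_pos c1]
  · have hv : Valid l w a b k ↔ (θ + 2 ≤ k ∨ w θ < a + 1) := by
      constructor
      · intro h
        by_contra h3
        push Not at h3
        have h4 := h.2.2.2.1
        rw [show k - 1 = θ by omega] at h4
        linarith [h3.2]
      · intro h
        refine ⟨by omega, hkl.le, fun j hj hjl => t4 j (by omega) hjl, ?_, ?_, fun _ => not_lt.1 c1⟩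
        · obtain h3 | h3 : k - 1 = θ ∨ θ < k - 1 := by omega
          · rw [h3]
            rcases h with h | h
            · omega
            · exact h
          · exact h1 _ h3 (by omega)
        · obtain ⟨j, hj, h5⟩ := hw.2 k (by omega) hkl
          exact ⟨j, hj, by linarith⟩
    by_cases c2 : θ + 2 ≤ k
    · by_cases c3 : b + 1 ≤ w (k - 1)
      · have := valid_pred_iff hw hθ hab hkl.le h1 c2 c3
        simp only [this, hv, c2, c3, c1]
        by_cases c4 : RealAbove θ w a b <;> simp [c4]
      · have m2 : ¬ Valid l w a b (k - 1) := fun h => c3 (h.2.2.2.2.2 (by omega))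
        have m4 : ¬ RealAbove θ w a b := fun h => by
          obtain h3 | h3 : k - 1 = θ + 1 ∨ θ + 1 < k - 1 := by omega
          · rw [h3] at c3
            exact c3 h.2
          · have := chain_lt t4 (j := θ + 1) (k := k - 1) (by omega) h3 (by omega)
            linarith [h.2]
        simp [m2, m4, hv, c2, c3, c1]
    -- The pivot is the first chain term: insertion before it fails exactly when `w θ` dominates a,
    -- and that is `RealAbove`.
    · obtain rfl : k = θ + 1 := by omega
      have m2 : ¬ Valid l w a b (θ + 1 - 1) := fun h => by
        have h3 := (h.eq_or hθ hab hk hkl.le h1 fun _ => h2).1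
        omega
      have m4 : RealAbove θ w a b ↔ ¬ w θ < a + 1 :=
        ⟨fun h => not_lt.2 h.1, fun h => ⟨not_lt.1 h, not_lt.1 c1⟩⟩
      simp only [m2, m4, hv, c2, c1]
      by_cases c4 : w θ < a + 1 <;> simp [c4]

open Classical in
theorem count_of_eq (hw : RealCorrect l w) (hθ : TailAt l w θ) (hab : a < b + 1)
    (h1 : ∀ j, θ < j → j < l → w j < a + 1) :
    (∑ i ∈ Finset.range (l + 1), if Valid l w a b i then 1 else 0) +
      (if EndValid l w a b then 1 else 0) +
      (if RealBelow l w a b ∨ RealAbove θ w a b then 1 else 0) +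
      (if Between l θ w a b then 1 else 0) + (if Crossing l w b a then 1 else 0) =
    1 + (if Between l θ w b a then 1 else 0) + if Crossing l w a b then 1 else 0 := by
  obtain ⟨t1, t2, t3, t4⟩ := id hθ
  have h2 : l < l → a + 1 ≤ w l := fun h => absurd h (lt_irrefl _)
  have n1 : ¬ Between l θ w a b := by
    rintro ⟨k, hk, hkl, h3, -⟩
    linarith [h1 k hk hkl]
  have hlast := h1 (l - 1) (by omega) (by omega)
  have hv : Valid l w a b l ↔ ∃ j < l, a < w j + 1 :=
    ⟨fun h => h.2.2.2.2.1, fun h => ⟨by omega, le_rfl, fun j hj hjl => by omega, hlast, h,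
      fun h => absurd h (lt_irrefl _)⟩⟩
  rw [sum_valid hθ hab (by omega) le_rfl h1 h2, if_neg n1]
  simp only [between_swap_iff hθ hab (by omega) le_rfl h1 h2, show θ + 2 ≤ l by omega, true_and]
  by_cases c1 : b + 1 ≤ w (l - 1)
  · have m1 : Valid l w a b l := hv.2 ⟨l - 1, by omega, by linarith⟩
    have m2 : ¬ EndValid l w a b := fun h => by linarith [h.2.1.2]
    have m3 : ¬ RealBelow l w a b := fun h => by linarith [h.2]
    have m4 : ¬ Crossing l w a b := fun h => by linarith [h.2.2]
    have m5 : ¬ Crossing l w b a := fun h => by linarith [h.2.1.2]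
    have := valid_pred_iff hw hθ hab le_rfl h1 (by omega) c1
    simp only [this, m1, m2, m3, m4, m5, c1]
    by_cases c4 : RealAbove θ w a b <;> simp [c4]
  · have m1 : ¬ Valid l w a b (l - 1) := fun h => c1 (h.2.2.2.2.2 (by omega))
    have m2 : ¬ RealAbove θ w a b := fun h => by
      obtain h3 | h3 : l - 1 = θ + 1 ∨ θ + 1 < l - 1 := by omega
      · rw [h3] at c1
        exact c1 h.2
      · have := chain_lt t4 (j := θ + 1) (k := l - 1) (by omega) h3 (by omega)
        linarith [h.2]
    simp only [m1, m2, c1, hv, or_false]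
    -- Appending the pair at the end is possible exactly when a does not dominate all of `w`. In
    -- that case `RealBelow` and `Crossing l w a b` agree and balance each other.
    by_cases c2 : ∃ j < l, a < w j + 1
    · obtain ⟨j, hj, h3⟩ := id c2
      have m3 : ¬ EndValid l w a b := fun h => by linarith [h.1 j hj]
      have m4 : ¬ Crossing l w b a := by
        rintro ⟨h4, h5, h6⟩
        obtain h7 | rfl : j < l - 1 ∨ j = l - 1 := by omega
        · linarith [h4 j h7]
        · linarith
      have m5 : Crossing l w a b ↔ RealBelow l w a b := by
        constructor
        · rintro ⟨h4, h5, h6⟩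
          exact ⟨h4, h6⟩
        · rintro ⟨h4, h5⟩
          refine ⟨h4, ⟨?_, hlast⟩, h5⟩
          obtain h7 | rfl : j < l - 1 ∨ j = l - 1 := by omega
          · linarith [h4 j h7]
          · exact h3
      simp [c2, m3, m4, m5]
    -- Now a dominates all of `w`, and exactly one of `RealBelow`, `EndValid` and `Crossing l w b a`
    -- holds.
    · have hQ : ∀ j < l, w j + 1 ≤ a := fun j hj => by
        by_contra h
        exact c2 ⟨j, hj, not_le.1 h⟩
      have hQ' := hQ (l - 1) (by omega)
      have m3 : ¬ Crossing l w a b := fun h => by linarith [h.2.1.1]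
      by_cases c3 : w (l - 1) + 1 ≤ b
      · have m4 : RealBelow l w a b := ⟨fun j hj => hQ j (by omega), c3⟩
        have m5 : ¬ EndValid l w a b := fun h => by linarith [h.2.1.1]
        have m6 : ¬ Crossing l w b a := fun h => by linarith [h.2.1.1]
        simp [c2, m3, m4, m5, m6]
      · have m4 : ¬ RealBelow l w a b := fun h => c3 h.2
        have m5 : EndValid l w a b ↔ ¬ Crossing l w b a := by
          constructor
          · rintro ⟨-, -, j, hj, h⟩ h'
            linarith [h'.1 j hj]
          · intro h
            refine ⟨hQ, ⟨not_le.1 c3, not_le.1 c1⟩, ?_⟩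
            by_contra h'
            push Not at h'
            exact h ⟨h', ⟨not_le.1 c3, not_le.1 c1⟩, hQ'⟩
        simp only [c2, m3, m4, m5]
        by_cases c4 : Crossing l w b a <;> simp [c4]

open Classical in
/-- The number of ways of inserting `a, b` into `w`, corrected by terms that cancel when `a` and
`b` are exchanged. -/
theorem count_insertions (hw : RealCorrect l w) (hθ : TailAt l w θ) (hab : a < b + 1)
    (hba : b < a + 1) :
    (∑ i ∈ Finset.range (l + 1), if Valid l w a b i then 1 else 0) +
      (if EndValid l w a b then 1 else 0) +
      (if RealBelow l w a b ∨ RealAbove θ w a b then 1 else 0) +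
      (if Between l θ w a b then 1 else 0) + (if Crossing l w b a then 1 else 0) =
    1 + (if Between l θ w b a then 1 else 0) + if Crossing l w a b then 1 else 0 := by
  -- The pivot k is the first term of the final chain that dominates a, or l if there is none; only
  -- the positions k and k - 1 can be valid.
  by_cases h : ∃ k, θ < k ∧ k < l ∧ a + 1 ≤ w k
  · obtain ⟨h1, h2, h3⟩ := Nat.find_spec h
    refine count_of_lt hw hθ hab hba h1 h2 (fun j hj hjk => ?_) h3
    by_contra h4
    exact Nat.find_min h hjk ⟨hj, by omega, not_lt.1 h4⟩
  · push Not at h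
    exact count_of_eq hw hθ hab h

end Count

/-! ### Sums of monomials over words and pairs of words -/

section Words

variable {U : Type*}

/-- The monomial of a word. -/
def wordMonomial {n : ℕ} (u : Fin n → U) : MvPolynomial U ℝ := ∏ i, MvPolynomial.X (u i)

theorem wordMonomial_comp {n k : ℕ} (σ : Fin k ≃ Fin n) (u : Fin n → U) :
    wordMonomial (u ∘ σ) = wordMonomial u :=
  Equiv.prod_comp σ fun i => (MvPolynomial.X (u i) : MvPolynomial U ℝ)

open Classical in
/-- The sum of the monomials of the words of length `n` that satisfy `A`. -/
def wordSum [Fintype U] {n : ℕ} (A : (Fin n → U) → Prop) : MvPolynomial U ℝ :=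
  ∑ u, if A u then wordMonomial u else 0

open Classical in
/-- The sum of the monomials of the pairs of words that satisfy `B`. -/
def pairSum [Fintype U] {n k : ℕ} (B : (Fin n → U) → (Fin k → U) → Prop) : MvPolynomial U ℝ :=
  ∑ x : (Fin n → U) × (Fin k → U), if B x.1 x.2 then wordMonomial x.1 * wordMonomial x.2 else 0

variable [Fintype U]

theorem wordSum_congr {n : ℕ} {A B : (Fin n → U) → Prop} (h : ∀ u, A u ↔ B u) :
    wordSum A = wordSum B := by
  rw [show A = B from funext fun u => propext (h u)]

theorem wordSum_and_add {n : ℕ} (A B : (Fin n → U) → Prop) :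
    wordSum (fun u => A u ∧ B u) + wordSum (fun u => A u ∧ ¬ B u) = wordSum A := by
  unfold wordSum
  rw [← Finset.sum_add_distrib]
  refine Finset.sum_congr rfl fun u _ => ?_
  by_cases h : A u <;> by_cases h' : B u <;> simp [h, h']

theorem wordSum_eq_zero {n : ℕ} {A : (Fin n → U) → Prop} (h : ∀ u, ¬ A u) : wordSum A = 0 :=
  Finset.sum_eq_zero fun u _ => if_neg (h u)

/-- Splitting a sum of words according to the unique index satisfying a condition. -/
theorem wordSum_eq_sum {n : ℕ} (s : Finset ℕ) {A : (Fin n → U) → Prop}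
    {B : ℕ → (Fin n → U) → Prop} (h : ∀ u, A u → ∃ i ∈ s, B i u)
    (h' : ∀ u, A u → ∀ i k, B i u → B k u → i = k) :
    wordSum A = ∑ i ∈ s, wordSum fun u => A u ∧ B i u := by
  unfold wordSum
  rw [Finset.sum_comm]
  refine Finset.sum_congr rfl fun u _ => ?_
  by_cases hA : A u
  · obtain ⟨i, hi, hB⟩ := h u hA
    rw [Finset.sum_eq_single i, if_pos hA, if_pos ⟨hA, hB⟩]
    · exact fun k _ hk => if_neg fun hk' => hk (h' u hA _ _ hk'.2 hB)
    · exact fun h => absurd hi h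
  · simp [hA]

theorem wordSum_comp {n k : ℕ} (σ : Fin k ≃ Fin n) {A : (Fin n → U) → Prop}
    {B : (Fin k → U) → Prop} (h : ∀ u, A u ↔ B (u ∘ σ)) : wordSum A = wordSum B := by
  unfold wordSum
  refine Fintype.sum_equiv (σ.symm.arrowCongr (Equiv.refl U)) _ _ fun u => ?_
  have h1 : σ.symm.arrowCongr (Equiv.refl U) u = u ∘ σ := rfl
  rw [h1, wordMonomial_comp]
  classical exact if_congr (h u) rfl rfl

theorem wordSum_eq_pairSum {n k r : ℕ} (σ : Fin n ⊕ Fin k ≃ Fin r) {A : (Fin r → U) → Prop}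
    {B : (Fin n → U) → (Fin k → U) → Prop}
    (h : ∀ u, A u ↔ B (fun j => u (σ (.inl j))) fun j => u (σ (.inr j))) :
    wordSum A = pairSum B := by
  unfold wordSum pairSum
  refine Fintype.sum_equiv
    ((σ.symm.arrowCongr (Equiv.refl U)).trans (Equiv.sumArrowEquivProdArrow _ _ _)) _ _ fun u => ?_
  have h1 : ((σ.symm.arrowCongr (Equiv.refl U)).trans (Equiv.sumArrowEquivProdArrow _ _ _)) u =
    (fun j => u (σ (.inl j)), fun j => u (σ (.inr j))) := rfl
  have h2 : wordMonomial u = wordMonomial (fun j => u (σ (.inl j))) *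
      wordMonomial (fun j => u (σ (.inr j))) := by
    unfold wordMonomial
    rw [← Equiv.prod_comp σ, Fintype.prod_sum_type]
  rw [h1, h2]
  classical exact if_congr (h u) rfl rfl

theorem wordSum_mul_wordSum {n k : ℕ} (A : (Fin n → U) → Prop) (B : (Fin k → U) → Prop) :
    wordSum A * wordSum B = pairSum fun u v => A u ∧ B v := by
  unfold wordSum pairSum
  rw [Fintype.sum_prod_type, Finset.sum_mul_sum]
  refine Finset.sum_congr rfl fun u _ => Finset.sum_congr rfl fun v _ => ?_
  by_cases h : A u <;> by_cases h' : B v <;> simp [h, h']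

theorem pairSum_swap {n : ℕ} {A B : (Fin n → U) → (Fin 2 → U) → Prop}
    (h : ∀ w q, A w q ↔ B w (q ∘ Equiv.swap 0 1)) : pairSum A = pairSum B := by
  unfold pairSum
  refine Fintype.sum_equiv (Equiv.prodCongr (Equiv.refl _)
    ((Equiv.swap (0 : Fin 2) 1).arrowCongr (Equiv.refl U))) _ _ fun x => ?_
  have h1 : Equiv.prodCongr (Equiv.refl _)
    ((Equiv.swap (0 : Fin 2) 1).arrowCongr (Equiv.refl U)) x = (x.1, x.2 ∘ Equiv.swap 0 1) := rfl
  rw [h1, wordMonomial_comp]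
  classical exact if_congr (h _ _) rfl rfl

end Words

/-! ### Translation from the order on `U` to real sequences -/

section Bridge

variable {U : Type*}

/-- The real numbers attached to a word, extended by zero. -/
def realWord (f : U → ℝ) {n : ℕ} (u : Fin n → U) (j : ℕ) : ℝ :=
  if h : j < n then f (u ⟨j, h⟩) else 0

theorem realWord_of_lt {f : U → ℝ} {n : ℕ} (u : Fin n → U) {j : ℕ} (h : j < n) :
    realWord f u j = f (u ⟨j, h⟩) := dif_pos h

variable [PartialOrder U] {f : U → ℝ}

theorem isCorrect_iff (hf : ∀ u w : U, u < w ↔ f u + 1 ≤ f w) {n : ℕ} (u : Fin n → U) :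
    IsCorrect u ↔ RealCorrect n (realWord f u) := by
  refine and_congr ⟨fun h j hj => ?_, fun h i j hij => ?_⟩ ⟨fun h j hj hjn => ?_, fun h j hj => ?_⟩
  · have := h ⟨j, by omega⟩ ⟨j + 1, hj⟩ rfl
    rw [hf, not_le] at this
    rwa [realWord_of_lt _ hj, realWord_of_lt _ (by omega)]
  · rw [hf, not_le]
    have h1 := j.2
    have := h i (by omega)
    rw [realWord_of_lt _ i.2, realWord_of_lt _ (by omega)] at this
    rwa [show (⟨i + 1, by omega⟩ : Fin n) = j from Fin.ext hij.symm] at this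
  · obtain ⟨i, hi, h'⟩ := h ⟨j, hjn⟩ hj
    rw [hf, not_le] at h'
    exact ⟨i, hi, by rwa [realWord_of_lt _ hjn, realWord_of_lt _ i.2]⟩
  · obtain ⟨i, hi, h'⟩ := h j hj j.2
    have h1 := j.2
    rw [realWord_of_lt _ h1, realWord_of_lt _ (by omega)] at h'
    exact ⟨⟨i, by omega⟩, hi, by rwa [hf, not_le]⟩

theorem isCorrect_two_iff (hf : ∀ u w : U, u < w ↔ f u + 1 ≤ f w) (q : Fin 2 → U) :
    IsCorrect q ↔ f (q 0) < f (q 1) + 1 ∧ f (q 1) < f (q 0) + 1 := by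
  rw [isCorrect_iff hf]
  have h0 : realWord f q 0 = f (q 0) := realWord_of_lt _ (by omega)
  have h1 : realWord f q 1 = f (q 1) := realWord_of_lt _ (by omega)
  constructor
  · rintro ⟨c1, c2⟩
    obtain ⟨i, hi, h⟩ := c2 1 one_pos (by omega)
    obtain rfl : i = 0 := by omega
    have := c1 0 (by omega)
    rw [zero_add, h0, h1] at this
    rw [h0, h1] at h
    exact ⟨this, h⟩
  · rintro ⟨c1, c2⟩
    refine ⟨fun j hj => ?_, fun j hj hj' => ⟨0, hj, ?_⟩⟩
    · obtain rfl : j = 0 := by omega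
      rwa [zero_add, h0, h1]
    · obtain rfl : j = 1 := by omega
      rwa [h0, h1]

theorem below_iff (hf : ∀ u w : U, u < w ↔ f u + 1 ≤ f w) {l : ℕ} (hl : 2 ≤ l) (w : Fin l → U)
    (q : Fin 2 → U) : Below w q ↔ RealBelow l (realWord f w) (f (q 0)) (f (q 1)) := by
  refine and_congr ⟨fun h j hj => ?_, fun h i hi => ?_⟩ ⟨fun h => ?_, fun h i hi => ?_⟩
  · rw [realWord_of_lt _ (by omega), ← hf]
    exact h _ (by dsimp only; omega)
  · have := h i (by omega)
    rwa [realWord_of_lt _ i.2, ← hf] at this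
  · rw [realWord_of_lt _ (by omega), ← hf]
    exact h _ (by dsimp only; omega)
  · rw [show l - 1 = i by omega, realWord_of_lt _ i.2, ← hf] at h
    exact h

/-- A correct sequence has no descents, so consecutive terms that are not ∼ must increase;
maximality of t therefore says that the terms after t form a chain. -/
theorem isGreatest_iff (hf : ∀ u w : U, u < w ↔ f u + 1 ≤ f w) {l : ℕ} (w : Fin l → U)
    (hw : RealCorrect l (realWord f w)) (t : ℕ) :
    IsGreatest {i : ℕ | ∃ hi : i + 1 < l, Sim (w ⟨i, by omega⟩) (w ⟨i + 1, hi⟩)} t ↔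
      TailAt l (realWord f w) t := by
  have hS : ∀ i, (∃ hi : i + 1 < l, Sim (w ⟨i, by omega⟩) (w ⟨i + 1, hi⟩)) ↔
      i + 1 < l ∧ realWord f w i < realWord f w (i + 1) + 1 ∧
        realWord f w (i + 1) < realWord f w i + 1 := by
    intro i
    constructor
    · rintro ⟨hi, h1, h2⟩
      rw [hf, not_le] at h1 h2
      rw [realWord_of_lt _ hi, realWord_of_lt _ (by omega)]
      exact ⟨hi, h2, h1⟩
    · rintro ⟨hi, h1, h2⟩
      rw [realWord_of_lt _ hi, realWord_of_lt _ (by omega)] at h1 h2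
      exact ⟨hi, by rwa [hf, not_le], by rwa [hf, not_le]⟩
  have hset : {i : ℕ | ∃ hi : i + 1 < l, Sim (w ⟨i, by omega⟩) (w ⟨i + 1, hi⟩)} =
      {i | i + 1 < l ∧ realWord f w i < realWord f w (i + 1) + 1 ∧
        realWord f w (i + 1) < realWord f w i + 1} := Set.ext hS
  rw [hset]
  constructor
  · rintro ⟨⟨h1, h2, h3⟩, h4⟩
    refine ⟨h1, h2, h3, fun j hj hjl => ?_⟩
    by_contra h
    have := h4 ⟨hjl, hw.1 j hjl, not_le.1 h⟩
    omega
  · rintro ⟨h1, h2, h3, h4⟩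
    refine ⟨⟨h1, h2, h3⟩, fun j ⟨hj1, hj2, hj3⟩ => ?_⟩
    by_contra h
    have := h4 j (not_le.1 h) hj1
    linarith

theorem above_iff (hf : ∀ u w : U, u < w ↔ f u + 1 ≤ f w) {l θ : ℕ} (w : Fin l → U)
    (q : Fin 2 → U) (hw : RealCorrect l (realWord f w)) (hθ : TailAt l (realWord f w) θ) :
    Above w q ↔ RealAbove θ (realWord f w) (f (q 0)) (f (q 1)) := by
  have h1 := hθ.1
  unfold RealAbove
  rw [realWord_of_lt _ h1, realWord_of_lt _ (show θ < l by omega)]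
  constructor
  · rintro ⟨t, ht, h2, h3, h4⟩
    obtain rfl := ((isGreatest_iff hf w hw t).1 h2).unique hθ
    exact ⟨(hf _ _).1 h3, (hf _ _).1 h4⟩
  · rintro ⟨h2, h3⟩
    exact ⟨θ, h1, (isGreatest_iff hf w hw θ).2 hθ, (hf _ _).2 h2, (hf _ _).2 h3⟩

end Bridge

/-! ### Taking two letters out of a correct word -/

/-- The bijection sending the first summand to the positions other than `i, i + 1`, and the second
one to `i, i + 1`. -/
def insertEquiv {l i : ℕ} (hi : i ≤ l) : Fin l ⊕ Fin 2 ≃ Fin (l + 2) :=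
  Equiv.ofBijective (Sum.elim (fun j => ⟨skip i j, by unfold skip; split_ifs <;> omega⟩)
    fun j => ⟨i + j, by omega⟩) <| by
    rw [Fintype.bijective_iff_injective_and_card]
    refine ⟨?_, by simp⟩
    rintro (a | a) (b | b) h <;>
      simp only [Sum.elim_inl, Sum.elim_inr, Fin.mk.injEq, skip] at h <;>
      simp only [Sum.inl.injEq, Sum.inr.injEq, reduceCtorEq, Fin.ext_iff] <;>
      first | omega | (split_ifs at h <;> omega)

/-- The bijection sending the first summand to the positions other than `l - 1, l + 1`, and the
second one to `l + 1, l - 1`. -/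
def endEquiv {l : ℕ} (hl : 2 ≤ l) : Fin l ⊕ Fin 2 ≃ Fin (l + 2) :=
  Equiv.ofBijective (Sum.elim (fun j => ⟨if (j : ℕ) < l - 1 then j else l, by split_ifs <;> omega⟩)
    fun j => ⟨l + 1 - 2 * j, by omega⟩) <| by
    rw [Fintype.bijective_iff_injective_and_card]
    refine ⟨?_, by simp⟩
    rintro (a | a) (b | b) h <;>
      simp only [Sum.elim_inl, Sum.elim_inr, Fin.mk.injEq] at h <;>
      simp only [Sum.inl.injEq, Sum.inr.injEq, reduceCtorEq, Fin.ext_iff] <;>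
      first | omega | (split_ifs at h <;> omega)

section

variable {U : Type*} [PartialOrder U] {f : U → ℝ}

theorem realCorrect_congr {n : ℕ} {g g' : ℕ → ℝ} (h : ∀ j < n, g j = g' j) :
    RealCorrect n g ↔ RealCorrect n g' := by
  refine and_congr (forall_congr' fun j => forall_congr' fun hj => ?_)
    (forall_congr' fun j => forall_congr' fun _ => forall_congr' fun hj =>
      exists_congr fun i => and_congr_right fun hi => ?_)
  · rw [h j (by omega), h (j + 1) hj]
  · rw [h j hj, h i (by omega)]

theorem valid_congr {l : ℕ} {g g' : ℕ → ℝ} (h : ∀ j < l, g j = g' j) {a b : ℝ} {i : ℕ} :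
    Valid l g a b i ↔ Valid l g' a b i := by
  refine and_congr_right fun h1 => and_congr_right fun h2 => ?_
  refine and_congr (forall_congr' fun j => forall_congr' fun _ => forall_congr' fun hj => ?_)
    (and_congr ?_ (and_congr (exists_congr fun j => and_congr_right fun hj => ?_)
      (forall_congr' fun hi => ?_)))
  · rw [h j (by omega), h (j + 1) hj]
  · rw [h (i - 1) (by omega)]
  · rw [h j (by omega)]
  · rw [h i hi]

variable (f) in
/-- The last term of `u` dominates the terms before position `i`, the antepenultimate one. -/
def Exceptional {l : ℕ} (u : Fin (l + 2) → U) (i : ℕ) : Prop :=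
  i + 1 = l ∧ ∀ j < i, realWord f u j + 1 ≤ realWord f u (l + 1)

variable [Fintype U]

theorem wordSum_valid (hf : ∀ u w : U, u < w ↔ f u + 1 ≤ f w) {l i : ℕ} (hl : 2 ≤ l) (hi : i ≤ l) :
    wordSum (fun u : Fin (l + 2) → U =>
      (IsCorrect u ∧ TailAt (l + 2) (realWord f u) i) ∧ ¬ Exceptional f u i) =
    pairSum fun (w : Fin l → U) (q : Fin 2 → U) => (IsCorrect w ∧ IsCorrect q) ∧
      Valid l (realWord f w) (f (q 0)) (f (q 1)) i := by
  refine wordSum_eq_pairSum (insertEquiv hi) fun u => ?_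
  have h0 : f (u (insertEquiv hi (.inr 0))) = realWord f u i := by
    rw [realWord_of_lt _ (by omega)]
    rfl
  have h1 : f (u (insertEquiv hi (.inr 1))) = realWord f u (i + 1) := by
    rw [realWord_of_lt _ (by omega)]
    rfl
  have h2 : ∀ j < l, realWord f (fun j => u (insertEquiv hi (.inl j))) j =
      realWord f u (skip i j) := by
    intro j hj
    rw [realWord_of_lt _ hj, realWord_of_lt _ (by unfold skip; split_ifs <;> omega)]
    rfl
  rw [isCorrect_iff hf, isCorrect_iff hf, isCorrect_two_iff hf, realCorrect_congr h2,
    valid_congr h2, h0, h1, and_assoc, and_assoc]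
  exact valid_iff hl _

theorem wordSum_exceptional (hf : ∀ u w : U, u < w ↔ f u + 1 ≤ f w) {l : ℕ} (hl : 2 ≤ l) :
    wordSum (fun u : Fin (l + 2) → U =>
      (IsCorrect u ∧ TailAt (l + 2) (realWord f u) (l - 1)) ∧ Exceptional f u (l - 1)) =
    pairSum fun (w : Fin l → U) (q : Fin 2 → U) => (IsCorrect w ∧ IsCorrect q) ∧
      EndValid l (realWord f w) (f (q 0)) (f (q 1)) := by
  refine wordSum_eq_pairSum (endEquiv hl) fun u => ?_
  have h0 : f (u (endEquiv hl (.inr 0))) = realWord f u (l + 1) := by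
    rw [realWord_of_lt _ (by omega)]
    rfl
  have h1 : f (u (endEquiv hl (.inr 1))) = realWord f u (l - 1) := by
    rw [realWord_of_lt _ (by omega)]
    rfl
  have h2 : ∀ j < l - 1, realWord f (fun j => u (endEquiv hl (.inl j))) j = realWord f u j := by
    intro j hj
    rw [realWord_of_lt _ (by omega), realWord_of_lt _ (by omega)]
    exact congrArg (fun x => f (u x)) (Fin.ext (if_pos hj))
  have h3 : realWord f (fun j => u (endEquiv hl (.inl j))) (l - 1) = realWord f u l := by
    rw [realWord_of_lt _ (by omega), realWord_of_lt _ (by omega)]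
    exact congrArg (fun x => f (u x)) (Fin.ext (if_neg (lt_irrefl _)))
  rw [isCorrect_iff hf, isCorrect_iff hf, isCorrect_two_iff hf, h0, h1, and_assoc, and_assoc,
    ← endValid_iff hl (realWord f u) _ h2 h3]
  exact and_congr_right fun _ => and_congr_right fun _ =>
    ⟨fun h => h.2, fun h => ⟨by omega, h⟩⟩

/-- Words are sorted by the last index with u_i ∼ u_{i+1}, which is at most l. Exceptional words
occur only at index l - 1 and contribute the separate summand. -/
theorem wordSum_correct_eq (hf : ∀ u w : U, u < w ↔ f u + 1 ≤ f w) {l : ℕ} (hl : 2 ≤ l) :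
    wordSum (fun u : Fin (l + 2) → U => IsCorrect u) =
      (∑ i ∈ Finset.range (l + 1), pairSum fun (w : Fin l → U) (q : Fin 2 → U) =>
        (IsCorrect w ∧ IsCorrect q) ∧ Valid l (realWord f w) (f (q 0)) (f (q 1)) i) +
      pairSum fun (w : Fin l → U) (q : Fin 2 → U) => (IsCorrect w ∧ IsCorrect q) ∧
        EndValid l (realWord f w) (f (q 0)) (f (q 1)) := by
  rw [wordSum_eq_sum (Finset.range (l + 1)) (B := fun i u => TailAt (l + 2) (realWord f u) i)
    (fun u hu => ?_) (fun u _ i k hi hk => hi.unique hk), ← wordSum_exceptional hf hl,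
    ← Finset.sum_congr rfl fun i hi =>
      wordSum_valid hf hl (Nat.lt_succ_iff.1 (Finset.mem_range.1 hi)),
    ← Finset.sum_congr rfl fun i _ => wordSum_and_add _ fun u => Exceptional f u i,
    Finset.sum_add_distrib, add_comm]
  · congr 1
    refine Finset.sum_eq_single (l - 1) (fun i _ hi => wordSum_eq_zero fun u h => hi ?_)
      (fun h => absurd (Finset.mem_range.2 (by omega)) h)
    have := h.2.1
    omega
  · obtain ⟨i, hi⟩ := exists_tailAt (by omega) ((isCorrect_iff hf u).1 hu)
    exact ⟨i, Finset.mem_range.2 (by have := hi.1; omega), hi⟩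

theorem MSum_eq_pairSum (l : ℕ) : MSum U l = pairSum fun (w : Fin l → U) (q : Fin 2 → U) =>
    (IsCorrect w ∧ IsCorrect q) ∧ (Below w q ∨ Above w q) := by
  unfold MSum MSet PSet pairSum
  rw [Finset.filter_filter, Finset.sum_filter]
  refine Finset.sum_congr rfl fun x _ => ?_
  dsimp only [wordMonomial]
  congr

/-- The power sum identity, with power sums expressed by correct sequences. -/
theorem correct_mul_correct_sub (hU : IsUnitInterval U) {l : ℕ} (hl : 2 ≤ l) :
    wordSum (fun u : Fin l → U => IsCorrect u) * wordSum (fun u : Fin 2 → U => IsCorrect u) -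
      wordSum (fun u : Fin (l + 2) → U => IsCorrect u) = MSum U l := by
  classical
  obtain ⟨f, -, hf⟩ := hU
  let R : (ℝ → ℝ → Prop) → (Fin l → U) → (Fin 2 → U) → Prop := fun P w q =>
    (IsCorrect w ∧ IsCorrect q) ∧ P (f (q 0)) (f (q 1))
  -- `Be` and `Cr` are the correction terms of `count_insertions`, with `Be'` and `Cr'` their images
  -- under exchanging q_0 and q_1. The index θ is quantified because it exists only for suitable w;
  -- for correct w it is unique.
  let Be : (Fin l → U) → (Fin 2 → U) → Prop := fun w q => (IsCorrect w ∧ IsCorrect q) ∧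
    ∃ θ, TailAt l (realWord f w) θ ∧ Between l θ (realWord f w) (f (q 0)) (f (q 1))
  let Be' : (Fin l → U) → (Fin 2 → U) → Prop := fun w q => (IsCorrect w ∧ IsCorrect q) ∧
    ∃ θ, TailAt l (realWord f w) θ ∧ Between l θ (realWord f w) (f (q 1)) (f (q 0))
  let Cr : (Fin l → U) → (Fin 2 → U) → Prop := fun w q => (IsCorrect w ∧ IsCorrect q) ∧
    Crossing l (realWord f w) (f (q 0)) (f (q 1))
  let Cr' : (Fin l → U) → (Fin 2 → U) → Prop := fun w q => (IsCorrect w ∧ IsCorrect q) ∧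
    Crossing l (realWord f w) (f (q 1)) (f (q 0))
  have hswap : ∀ q : Fin 2 → U, IsCorrect q ↔ IsCorrect (q ∘ Equiv.swap 0 1) := by
    intro q
    rw [isCorrect_two_iff hf, isCorrect_two_iff hf, and_comm]
    simp
  have hBe : pairSum Be = pairSum Be' := pairSum_swap fun w q => by
    simp only [Be, Be', ← hswap, Function.comp_apply, Equiv.swap_apply_left,
      Equiv.swap_apply_right]
  have hCr : pairSum Cr = pairSum Cr' := pairSum_swap fun w q => by
    simp only [Cr, Cr', ← hswap, Function.comp_apply, Equiv.swap_apply_left,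
      Equiv.swap_apply_right]
  -- Summand by summand this is `count_insertions`, cast from ℕ and multiplied by the monomial;
  -- keeping all terms positive avoids subtraction in ℕ.
  have key : wordSum (fun u : Fin (l + 2) → U => IsCorrect u) + MSum U l + pairSum Be +
      pairSum Cr' = pairSum (fun (w : Fin l → U) (q : Fin 2 → U) => IsCorrect w ∧ IsCorrect q) +
      pairSum Be' + pairSum Cr := by
    rw [wordSum_correct_eq hf hl, MSum_eq_pairSum]
    unfold pairSum
    rw [Finset.sum_comm]
    simp only [← Finset.sum_add_distrib]
    refine Finset.sum_congr rfl fun x _ => ?_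
    by_cases hx : IsCorrect x.1 ∧ IsCorrect x.2
    · have hw := (isCorrect_iff hf _).1 hx.1
      obtain ⟨hq1, hq2⟩ := (isCorrect_two_iff hf _).1 hx.2
      obtain ⟨θ, hθ⟩ := exists_tailAt hl hw
      have hex : ∀ P : ℕ → Prop, (∃ t, TailAt l (realWord f x.1) t ∧ P t) ↔ P θ := fun P =>
        ⟨fun ⟨t, ht, h⟩ => ht.unique hθ ▸ h, fun h => ⟨θ, hθ, h⟩⟩
      have hc := count_insertions hw hθ hq1 hq2
      have hc' := congrArg (fun n : ℕ => (n : MvPolynomial U ℝ) *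
        (wordMonomial x.1 * wordMonomial x.2)) hc
      simp only [Nat.cast_add, Nat.cast_sum, Nat.cast_ite, Nat.cast_one, Nat.cast_zero, add_mul,
        Finset.sum_mul, ite_mul, one_mul, zero_mul] at hc'
      simp only [Be, Be', Cr, Cr', hx, true_and, hex, if_true, below_iff hf hl,
        above_iff hf x.1 x.2 hw hθ]
      convert hc'
    · simp [Be, Be', Cr, Cr', hx]
  rw [wordSum_mul_wordSum, sub_eq_iff_eq_add]
  rw [hBe, hCr] at key
  linear_combination -key

end

/-! ### Power sums and correct words -/

section Rotation

variable {V : Type*} [PartialOrder V]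

/-- Among the first `n` terms of `g`, exactly the first `k` steps are descents. -/
def InitialDescents (n k : ℕ) (g : ℕ → V) : Prop :=
  ∀ j, j + 1 < n → (g (j + 1) < g j ↔ j + 1 ≤ k)

/-- `g m` dominates all earlier terms. -/
def IsRecord (g : ℕ → V) (m : ℕ) : Prop := ∀ j < m, g j < g m

/-- `g` has a record after position `k`. -/
def HasRecord (n k : ℕ) (g : ℕ → V) : Prop := ∃ m, k < m ∧ m < n ∧ IsRecord g m

/-- `m` is the last record of `g`, and it comes after position `k`. -/
def LastRecord (n k : ℕ) (g : ℕ → V) (m : ℕ) : Prop :=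
  k < m ∧ IsRecord g m ∧ ∀ m', m < m' → m' < n → ¬ IsRecord g m'

/-- `g 0` dominates the following `m` terms, but no more, and `k < m`. -/
def FirstDominates (n k : ℕ) (g : ℕ → V) (m : ℕ) : Prop :=
  k < m ∧ (∀ j, 1 ≤ j → j ≤ m → g j < g 0) ∧ (m + 1 < n → ¬ g (m + 1) < g 0)

/-- Here h is g with the letter at m moved to the front. As a record that letter exceeds all it
jumps over, which creates one more initial descent and destroys the records up to m; later records
are unaffected. Conversely, the front letter returns to the end of the run of letters it dominates.
Any partial order will do. -/
theorem rotation_iff {n k m : ℕ} {g h : ℕ → V} (hm : m < n) (h0 : h 0 = g m)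
    (h1 : ∀ j, 1 ≤ j → j ≤ m → h j = g (j - 1)) (h2 : ∀ j, m < j → j < n → h j = g j) :
    (InitialDescents n k g ∧ LastRecord n k g m) ↔
      (InitialDescents n (k + 1) h ∧ ¬ HasRecord n (k + 1) h) ∧ FirstDominates n k h m := by
  have h1' : ∀ j < m, g j = h (j + 1) := fun j hj => by
    rw [h1 (j + 1) (by omega) (by omega), Nat.add_sub_cancel]
  have hrec : ∀ m', m < m' → m' < n → (IsRecord h m' ↔ IsRecord g m') := by
    intro m' hm' hmn
    unfold IsRecord
    rw [h2 m' hm' hmn]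
    constructor
    · intro H j hj
      obtain h | h | h := lt_trichotomy j m
      · rw [h1' j h]
        exact H _ (by omega)
      · rw [h, ← h0]
        exact H _ (by omega)
      · rw [← h2 j h (by omega)]
        exact H _ (by omega)
    · intro H j hj
      obtain h | h | h : j = 0 ∨ (1 ≤ j ∧ j ≤ m) ∨ m < j := by omega
      · rw [h, h0]
        exact H _ (by omega)
      · rw [h1 j h.1 h.2]
        exact H _ (by omega)
      · rw [h2 j h (by omega)]
        exact H _ (by omega)
  constructor
  · rintro ⟨hX, hk, hr, hl⟩
    have hdom : ∀ j, 1 ≤ j → j ≤ m → h j < h 0 := fun j hj hjm => by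
      rw [h1 j hj hjm, h0]
      exact hr _ (by omega)
    refine ⟨⟨fun j hj => ?_, ?_⟩, hk, hdom, fun hmn => ?_⟩
    · obtain h | h | h | h : j = 0 ∨ (1 ≤ j ∧ j + 1 ≤ m) ∨ j = m ∨ m < j := by omega
      · rw [h]
        exact iff_of_true (hdom _ (by omega) (by omega)) (by omega)
      · rw [h1 _ (by omega) h.2, h1 _ h.1 (by omega), Nat.add_sub_cancel]
        have := hX (j - 1) (by omega)
        rw [Nat.sub_add_cancel h.1] at this
        rw [this]
        omega
      -- At the gap left by the moved letter, a descent to g (m + 1) from g (m - 1) < g m would give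
      -- a descent of g at m, beyond the first k steps.
      · refine iff_of_false (fun H => ?_) (by omega)
        rw [h, h2 _ (by omega) (by omega), h1 m (by omega) le_rfl] at H
        have := (hX m (by omega)).1 (H.trans (hr _ (by omega)))
        omega
      · rw [h2 _ (by omega) hj, h2 _ h (by omega), hX j hj]
        omega
    · rintro ⟨m', hm', hmn, H⟩
      rcases lt_or_ge m m' with h | h
      · exact hl m' h hmn ((hrec m' h hmn).1 H)
      · exact lt_asymm (H 0 (by omega)) (hdom m' (by omega) h)
    · rw [h2 _ (by omega) hmn, h0, hX m hmn]
      omega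
  · rintro ⟨⟨hX, hR⟩, hk, hdom, hmax⟩
    refine ⟨fun j hj => ?_, hk, fun j hj => ?_, fun m' hm' hmn H => ?_⟩
    · obtain h | h | h | h : j + 1 < m ∨ j + 1 = m ∨ j = m ∨ m < j := by omega
      · rw [h1' _ h, h1' j (by omega), hX (j + 1) (by omega)]
        omega
      · refine iff_of_false (fun H => ?_) (by omega)
        rw [h, h1' j (by omega), ← h0, h] at H
        exact lt_asymm H (hdom m (by omega) le_rfl)
      · refine iff_of_false (fun H => ?_) (by omega)
        rw [h, ← h2 _ (by omega) (by omega), ← h0] at H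
        exact hmax (by omega) H
      · rw [← h2 _ (by omega) hj, ← h2 _ h (by omega), hX j hj]
        omega
    · rw [h1' j hj, ← h0]
      exact hdom _ (by omega) (by omega)
    · exact hR ⟨m', by omega, hmn, (hrec m' hm' hmn).2 H⟩

theorem HasRecord.exists_last {n k : ℕ} {g : ℕ → V} (h : HasRecord n k g) :
    ∃ m < n, LastRecord n k g m := by
  classical
  obtain ⟨m, hm, hmn, hr⟩ := h
  let Q : ℕ → Prop := fun m => k < m ∧ m < n ∧ IsRecord g m
  have hQ : Q (Nat.findGreatest Q n) := Nat.findGreatest_spec (P := Q) hmn.le ⟨hm, hmn, hr⟩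
  refine ⟨_, hQ.2.1, hQ.1, hQ.2.2, fun m' hm' hmn' H => ?_⟩
  exact Nat.findGreatest_is_greatest (P := Q) hm' hmn'.le ⟨hQ.1.trans hm', hmn', H⟩

theorem LastRecord.unique {n k m m' : ℕ} {g : ℕ → V} (h : LastRecord n k g m)
    (h' : LastRecord n k g m') (hm : m < n) (hm' : m' < n) : m = m' := by
  rcases lt_trichotomy m m' with h1 | h1 | h1
  · exact absurd h'.2.1 (h.2.2 _ h1 hm')
  · exact h1
  · exact absurd h.2.1 (h'.2.2 _ h1 hm)

theorem InitialDescents.lt {n k : ℕ} {g : ℕ → V} (h : InitialDescents n k g) {i j : ℕ}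
    (hij : i < j) (hjk : j ≤ k) (hjn : j < n) : g j < g i := by
  induction j, hij using Nat.le_induction with
  | base => exact (h i hjn).2 hjk
  | succ j hj ih => exact ((h j hjn).2 hjk).trans (ih (by omega) (by omega))

/-- The k + 1 initial descents keep the first letters below g 0, so the run dominated by g 0 has
length greater than k. -/
theorem InitialDescents.exists_firstDominates {n k : ℕ} {g : ℕ → V}
    (h : InitialDescents n (k + 1) g) (hk : k + 1 < n) : ∃ m < n, FirstDominates n k g m := by
  classical
  have hex : ∃ m, k < m ∧ m < n ∧ (m + 1 < n → ¬ g (m + 1) < g 0) :=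
    ⟨n - 1, by omega, by omega, fun h => by omega⟩
  obtain ⟨h1, h2, h3⟩ := Nat.find_spec hex
  refine ⟨_, h2, h1, fun j hj hjm => ?_, h3⟩
  rcases le_or_gt j (k + 1) with h4 | h4
  · exact h.lt hj h4 (by omega)
  · have := Nat.find_min hex (m := j - 1) (by omega)
    by_contra h5
    refine this ⟨by omega, by omega, fun _ => ?_⟩
    rwa [Nat.sub_add_cancel hj]

theorem FirstDominates.unique {n k m m' : ℕ} {g : ℕ → V} (h : FirstDominates n k g m)
    (h' : FirstDominates n k g m') (hm : m < n) (hm' : m' < n) : m = m' := by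
  rcases lt_trichotomy m m' with h1 | h1 | h1
  · exact absurd (h'.2.1 _ (by omega) h1) (h.2.2 (by omega))
  · exact h1
  · exact absurd (h.2.1 _ (by omega) h1) (h'.2.2 (by omega))

end Rotation

/-! ### Descents, records and chains in words -/

section Words

variable {U : Type*}

/-- A word, extended by `⊥`. -/
def natWord {n : ℕ} (u : Fin n → U) (j : ℕ) : WithBot U := if h : j < n then u ⟨j, h⟩ else ⊥

theorem natWord_of_lt {n : ℕ} (u : Fin n → U) {j : ℕ} (h : j < n) :
    natWord u j = u ⟨j, h⟩ := dif_pos h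

/-- The permutation whose composition with a word moves the letter at `m` to the front. -/
def toFront {n m : ℕ} (hm : m < n) : Fin n ≃ Fin n :=
  Equiv.ofBijective (fun j => ⟨if (j : ℕ) = 0 then m else if (j : ℕ) ≤ m then j - 1 else j, by
      split_ifs <;> omega⟩) <| by
    rw [← Finite.injective_iff_bijective]
    intro a b h
    simp only [Fin.mk.injEq] at h
    rw [Fin.ext_iff]
    split_ifs at h <;> omega

variable [PartialOrder U]

theorem isCorrect_iff_natWord {n : ℕ} (u : Fin n → U) :
    IsCorrect u ↔ InitialDescents n 0 (natWord u) ∧ ¬ HasRecord n 0 (natWord u) := by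
  refine and_congr ⟨fun h j hj => ?_, fun h i j hij => ?_⟩ ⟨?_, fun h j hj => ?_⟩
  · refine iff_of_false ?_ (by omega)
    rw [natWord_of_lt _ hj, natWord_of_lt _ (by omega), WithBot.coe_lt_coe]
    exact h _ _ rfl
  · have hj := j.2
    have := (h i (by omega)).1.mt (by omega)
    rw [natWord_of_lt _ i.2, natWord_of_lt _ (by omega), WithBot.coe_lt_coe] at this
    rwa [show (⟨i + 1, by omega⟩ : Fin n) = j from Fin.ext hij.symm] at this
  · rintro h ⟨m, hm, hmn, hr⟩
    obtain ⟨i, hi, h'⟩ := h ⟨m, hmn⟩ hm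
    have := hr i hi
    rw [natWord_of_lt _ i.2, natWord_of_lt _ hmn, WithBot.coe_lt_coe] at this
    exact h' this
  · by_contra H
    push Not at H
    refine h ⟨j, hj, j.2, fun i hi => ?_⟩
    rw [natWord_of_lt _ j.2, natWord_of_lt _ (hi.trans j.2), WithBot.coe_lt_coe]
    exact H _ hi

variable [Fintype U]

variable (U) in
/-- Words beginning with `k` descents, followed by no further descents. -/
def descentSum (n k : ℕ) : MvPolynomial U ℝ :=
  wordSum fun u : Fin n → U => InitialDescents n k (natWord u)

variable (U) in
/-- Words beginning with `k` descents, followed by no further descents and no further records. -/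
def recordFreeSum (n k : ℕ) : MvPolynomial U ℝ :=
  wordSum fun u : Fin n → U => InitialDescents n k (natWord u) ∧ ¬ HasRecord n k (natWord u)

/-- The words having a record after k are matched with the record-free words with one more initial
descent, by moving the last such record to the front. Both sides are sorted by the position m
involved, so that for fixed m the move is one permutation of positions. -/
theorem descentSum_eq {n k : ℕ} (hk : k + 1 < n) :
    descentSum U n k = recordFreeSum U n (k + 1) + recordFreeSum U n k := by
  unfold descentSum recordFreeSum
  rw [← wordSum_and_add _ fun u => HasRecord n k (natWord u)]
  congr 1
  rw [wordSum_eq_sum (Finset.range n) (B := fun m u => m < n ∧ LastRecord n k (natWord u) m)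
    (fun u hu => ?_) fun u _ i k hi hk => hi.2.unique hk.2 hi.1 hk.1,
    wordSum_eq_sum (Finset.range n) (B := fun m u => m < n ∧ FirstDominates n k (natWord u) m)
    (fun u hu => ?_) fun u _ i k hi hk => hi.2.unique hk.2 hi.1 hk.1]
  · refine Finset.sum_congr rfl fun m hm => ?_
    rw [Finset.mem_range] at hm
    refine wordSum_comp (toFront hm) fun u => ?_
    have hj : ∀ j (hj : j < n), natWord (u ∘ toFront hm) j =
        natWord u (if j = 0 then m else if j ≤ m then j - 1 else j) := by
      intro j hj
      rw [natWord_of_lt _ hj, natWord_of_lt _ (by split_ifs <;> omega)]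
      rfl
    have key := rotation_iff (n := n) (k := k) (m := m) (g := natWord u)
      (h := natWord (u ∘ toFront hm)) hm
      (by rw [hj 0 (by omega), if_pos rfl])
      (fun j h1 h2 => by rw [hj j (by omega), if_neg (by omega), if_pos h2])
      (fun j h1 h2 => by rw [hj j (by omega), if_neg (by omega), if_neg (by omega)])
    simp only [hm, true_and]
    rw [← key]
    exact ⟨fun h => ⟨h.1.1, h.2⟩, fun h => ⟨⟨h.1, m, h.2.1, hm, h.2.2.1⟩, h.2⟩⟩
  · obtain ⟨m, hm, h⟩ := hu.1.exists_firstDominates hk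
    exact ⟨m, Finset.mem_range.2 hm, hm, h⟩
  · obtain ⟨m, hm, h⟩ := hu.2.exists_last
    exact ⟨m, Finset.mem_range.2 hm, hm, h⟩

theorem descentSum_last {n : ℕ} : descentSum U (n + 1) n = recordFreeSum U (n + 1) n := by
  refine wordSum_congr fun u => ⟨fun h => ⟨h, ?_⟩, fun h => h.1⟩
  rintro ⟨m, h1, h2, -⟩
  omega

/-- The relation `descentSum_eq` telescopes, ending at k = n where no later record is possible;
correct words are the record-free words with k = 0. -/
theorem correct_eq_alternating_sum (n : ℕ) :
    wordSum (fun u : Fin (n + 1) → U => IsCorrect u) =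
      ∑ k ∈ Finset.range (n + 1), (-1) ^ k * descentSum U (n + 1) k := by
  have key : ∀ m ≤ n, ∑ k ∈ Finset.range m, (-1) ^ k * descentSum U (n + 1) k =
      recordFreeSum U (n + 1) 0 - (-1) ^ m * recordFreeSum U (n + 1) m := by
    intro m hm
    induction m with
    | zero => simp
    | succ m ih =>
      rw [Finset.sum_range_succ, ih (by omega), descentSum_eq (by omega)]
      ring
  rw [Finset.sum_range_succ, key n le_rfl, descentSum_last, sub_add_cancel]
  exact wordSum_congr fun u => isCorrect_iff_natWord u

/-- The first `j` letters form a decreasing chain, and there are no descents from the `j`-th letter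
on. -/
def SplitWord (n j : ℕ) (u : Fin n → U) : Prop :=
  ∀ i, i + 1 < n → i + 1 ≠ j → (natWord u (i + 1) < natWord u i ↔ i + 1 < j)

/-- The step from index j to j + 1 is unconstrained: a descent there gives j + 1 initial descents, a
non-descent gives j. For j + 1 = n this step does not exist and only one term remains. -/
theorem splitSum_succ {n j : ℕ} (hj : j < n) :
    wordSum (fun u : Fin n → U => SplitWord n (j + 1) u) =
      (if j + 1 < n then descentSum U n (j + 1) else 0) + descentSum U n j := by
  split_ifs with hjn
  · rw [← wordSum_and_add _ fun u => natWord u (j + 1) < natWord u j]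
    congr 1
    · refine wordSum_congr fun u => ⟨fun h i hi => ?_, fun h => ⟨fun i hi hij => ?_, ?_⟩⟩
      · by_cases hij : i = j
        · rw [hij]
          exact iff_of_true h.2 le_rfl
        · rw [h.1 i hi (by omega)]
          omega
      · rw [h i hi]
        omega
      · exact (h j hjn).2 le_rfl
    · refine wordSum_congr fun u => ⟨fun h i hi => ?_, fun h => ⟨fun i hi hij => ?_, ?_⟩⟩
      · by_cases hij : i = j
        · rw [hij]
          exact iff_of_false h.2 (by omega)
        · rw [h.1 i hi (by omega)]
          omega
      · rw [h i hi]
        omega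
      · rw [h j hjn]
        omega
  · rw [zero_add]
    refine wordSum_congr fun u => forall_congr' fun i => forall_congr' fun hi => ?_
    refine ⟨fun h => ?_, fun h hij => ?_⟩
    · rw [h (by omega)]
      omega
    · rw [h]
      omega

theorem splitSum_zero (n : ℕ) :
    wordSum (fun u : Fin n → U => SplitWord n 0 u) = descentSum U n 0 := by
  refine wordSum_congr fun u => forall_congr' fun i => forall_congr' fun hi => ?_
  simp

variable (U) in
/-- The sum of the words without descents. -/
def noDescentSum (n : ℕ) : MvPolynomial U ℝ := descentSum U n 0

theorem splitSum_add (j m : ℕ) :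
    wordSum (fun u : Fin (j + m) → U => SplitWord (j + m) j u) =
      wordSum (fun u : Fin j → U => InitialDescents j j (natWord u)) * noDescentSum U m := by
  unfold noDescentSum descentSum
  rw [wordSum_mul_wordSum]
  refine wordSum_eq_pairSum finSumFinEquiv fun u => ?_
  have h1 : ∀ i < j, natWord (fun i => u (finSumFinEquiv (.inl i))) i = natWord u i := by
    intro i hi
    rw [natWord_of_lt _ hi, natWord_of_lt _ (by omega)]
    rfl
  have h2 : ∀ i < m, natWord (fun i => u (finSumFinEquiv (.inr i))) i = natWord u (j + i) := by
    intro i hi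
    rw [natWord_of_lt _ hi, natWord_of_lt _ (by omega)]
    rfl
  constructor
  · intro h
    refine ⟨fun i hi => ?_, fun i hi => ?_⟩
    · rw [h1 _ hi, h1 i (by omega), h i (by omega) (by omega)]
      omega
    · rw [h2 _ hi, h2 i (by omega), ← add_assoc, h (j + i) (by omega) (by omega)]
      omega
  · rintro ⟨h3, h4⟩ i hi hij
    rcases lt_or_ge (i + 1) j with h | h
    · rw [← h1 _ h, ← h1 i (by omega), h3 i h]
      omega
    · have := h4 (i - j) (by omega)
      rw [h2 _ (by omega), h2 _ (by omega), show j + (i - j + 1) = i + 1 by omega,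
        show j + (i - j) = i by omega] at this
      rw [this]
      omega

/-- Stable sets of the incomparability graph are chains, and each chain has exactly one decreasing
enumeration. -/
theorem chainSum_eq (hU : IsUnitInterval U) (j : ℕ) :
    wordSum (fun u : Fin j → U => InitialDescents j j (natWord u)) = eG (inc U) j := by
  classical
  obtain ⟨f, hinj, hf⟩ := hU
  have hanti : ∀ u : Fin j → U, InitialDescents j j (natWord u) ↔ StrictAnti u := by
    intro u
    refine ⟨fun h a b hab => ?_, fun h i hi => iff_of_true ?_ hi.le⟩
    · have := h.lt (show (a : ℕ) < b from hab) b.2.le b.2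
      rwa [natWord_of_lt _ b.2, natWord_of_lt _ a.2, WithBot.coe_lt_coe] at this
    · rw [natWord_of_lt _ hi, natWord_of_lt _ (by omega), WithBot.coe_lt_coe]
      exact h (Fin.mk_lt_mk.2 (Nat.lt_succ_self i))
  have hfilter : wordSum (fun u : Fin j → U => StrictAnti u) =
      ∑ u : Fin j → U with StrictAnti u, wordMonomial u := by
    rw [Finset.sum_filter]
    refine Finset.sum_congr rfl fun u _ => ?_
    congr
  rw [wordSum_congr hanti, hfilter, eG]
  refine Finset.sum_bij (fun u _ => Finset.univ.image u) (fun u hu => ?_) (fun u hu v hv h => ?_)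
    (fun S hS => ?_) (fun u hu => ?_)
  · rw [Finset.mem_filter] at hu ⊢
    refine ⟨Finset.mem_univ _, ?_, ?_⟩
    · rw [Finset.card_image_of_injective _ hu.2.injective, Finset.card_univ, Fintype.card_fin]
    · rw [Finset.coe_image, Finset.coe_univ, Set.image_univ]
      rintro _ ⟨a, rfl⟩ _ ⟨b, rfl⟩ hab ⟨h1, h2⟩
      rcases le_total a b with h | h
      · exact h2 (hu.2.antitone h)
      · exact h1 (hu.2.antitone h)
  · rw [Finset.mem_filter] at hu hv
    have hr : Set.range u = Set.range v := by
      have := congrArg (fun s : Finset U => (s : Set U)) h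
      simpa using this
    exact (hu.2.range_inj hv.2).1 hr
  · rw [Finset.mem_filter] at hS
    obtain ⟨-, hcard, hind⟩ := hS
    -- The injective f puts S in linear order, and on comparable elements this agrees with the order
    -- of `U`; `Fin.rev` makes the enumeration decreasing.
    have hcard' : (S.image f).card = j := by rw [Finset.card_image_of_injective _ hinj, hcard]
    have hv : ∀ i : Fin j, ∃ v ∈ S, f v = (S.image f).orderEmbOfFin hcard' i := fun i =>
      Finset.mem_image.1 (Finset.orderEmbOfFin_mem _ hcard' i)
    choose v hvS hvf using hv
    have hanti' : StrictAnti (v ∘ Fin.rev) := by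
      intro a b hab
      have h1 : f (v (Fin.rev b)) < f (v (Fin.rev a)) := by
        rw [hvf, hvf]
        exact ((S.image f).orderEmbOfFin hcard').strictMono (Fin.rev_lt_rev.2 hab)
      have h2 := hind (hvS (Fin.rev b)) (hvS (Fin.rev a)) fun h => by
        rw [h] at h1
        exact lt_irrefl _ h1
      by_contra h3
      refine h2 ⟨fun h4 => ?_, fun h4 => ?_⟩
      · rcases h4.lt_or_eq with h5 | h5
        · exact h3 h5
        · rw [h5] at h1
          exact lt_irrefl _ h1
      · rcases h4.lt_or_eq with h5 | h5
        · rw [hf] at h5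
          linarith
        · rw [h5] at h1
          exact lt_irrefl _ h1
    refine ⟨v ∘ Fin.rev, Finset.mem_filter.2 ⟨Finset.mem_univ _, hanti'⟩, ?_⟩
    refine Finset.eq_of_subset_of_card_le (fun x hx => ?_) ?_
    · obtain ⟨i, -, rfl⟩ := Finset.mem_image.1 hx
      exact hvS _
    · rw [Finset.card_image_of_injective _ hanti'.injective, hcard, Finset.card_univ,
        Fintype.card_fin]
  · rw [Finset.mem_filter] at hu
    rw [Finset.prod_image fun a _ b _ h => hu.2.injective h]
    rfl

end Words

/-! ### Generating functions and Newton's identities -/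

section Newton

variable {U : Type*} [PartialOrder U] [Fintype U]

theorem eG_mul_noDescentSum (hU : IsUnitInterval U) {n j m : ℕ} (h : j + m = n) :
    eG (inc U) j * noDescentSum U m = wordSum fun u : Fin n → U => SplitWord n j u := by
  subst h
  rw [splitSum_add, chainSum_eq hU]

theorem noDescentSum_zero : noDescentSum U 0 = 1 := by
  unfold noDescentSum descentSum wordSum
  refine (Fintype.sum_unique _).trans ((if_pos fun j hj => by omega).trans ?_)
  simp [wordMonomial]

theorem eG_zero {V : Type*} [Fintype V] (G : SimpleGraph V) : eG G 0 = 1 := by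
  classical
  unfold eG
  refine (Finset.sum_eq_single ∅ (fun S hS h => absurd ?_ h) fun h => absurd ?_ h).trans (by simp)
  · rw [Finset.mem_filter] at hS
    exact Finset.card_eq_zero.1 hS.2.1
  · simp

/-- The generating function of `(-1) ^ j e_j^U`. -/
def altE (U : Type*) [PartialOrder U] [Fintype U] : PowerSeries (MvPolynomial U ℝ) :=
  PowerSeries.mk fun j => (-1) ^ j * eG (inc U) j

/-- The generating function of `(-1) ^ j j e_j^U`. -/
def altDE (U : Type*) [PartialOrder U] [Fintype U] : PowerSeries (MvPolynomial U ℝ) :=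
  PowerSeries.mk fun j => (-1) ^ j * j * eG (inc U) j

theorem sum_split (hU : IsUnitInterval U) (n : ℕ) (c : ℕ → MvPolynomial U ℝ) :
    ∑ a ∈ Finset.HasAntidiagonal.antidiagonal (n + 1), c a.1 * (eG (inc U) a.1 * noDescentSum U a.2) =
      c 0 * descentSum U (n + 1) 0 + ∑ j ∈ Finset.range (n + 1), c (j + 1) *
        ((if j + 1 < n + 1 then descentSum U (n + 1) (j + 1) else 0) + descentSum U (n + 1) j) := by
  have h : ∀ a ∈ Finset.HasAntidiagonal.antidiagonal (n + 1),
      c a.1 * (eG (inc U) a.1 * noDescentSum U a.2) =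
        c a.1 * wordSum fun u : Fin (n + 1) → U => SplitWord (n + 1) a.1 u := fun a ha => by
    rw [eG_mul_noDescentSum hU (Finset.HasAntidiagonal.mem_antidiagonal.1 ha)]
  rw [Finset.sum_congr rfl h, Finset.Nat.sum_antidiagonal_eq_sum_range_succ_mk, Finset.sum_range_succ', splitSum_zero,
    add_comm]
  congr 1
  refine Finset.sum_congr rfl fun j hj => ?_
  rw [splitSum_succ (Finset.mem_range.1 hj)]

/-- With e_j h_{n-j} = D_j + D_{j-1}, the alternating sum telescopes to zero in every positive
degree. -/
theorem altE_mul_noDescent (hU : IsUnitInterval U) :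
    altE U * PowerSeries.mk (noDescentSum U) = 1 := by
  ext n
  congr 1
  rw [PowerSeries.coeff_mul, PowerSeries.coeff_one]
  simp only [altE, PowerSeries.coeff_mk, mul_assoc]
  rcases n with _ | n
  · simp [eG_zero, noDescentSum_zero]
  rw [if_neg n.succ_ne_zero, sum_split hU n fun j => (-1) ^ j]
  have key : ∀ m ≤ n + 1, ∑ j ∈ Finset.range m, (-1) ^ (j + 1) *
      ((if j + 1 < n + 1 then descentSum U (n + 1) (j + 1) else 0) + descentSum U (n + 1) j) =
      (-1) ^ m * (if m < n + 1 then descentSum U (n + 1) m else 0) - descentSum U (n + 1) 0 := by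
    intro m hm
    induction m with
    | zero => simp
    | succ m ih =>
      rw [Finset.sum_range_succ, ih (by omega), if_pos (show m < n + 1 by omega)]
      ring
  rw [key _ le_rfl, if_neg (lt_irrefl _)]
  ring

variable (U) in
/-- The generating function of the sums over correct words. -/
def correctSeries : PowerSeries (MvPolynomial U ℝ) :=
  PowerSeries.mk fun n => if n = 0 then 0 else wordSum fun u : Fin n → U => IsCorrect u

/-- The weights j turn the telescoping into summation by parts: each D_k keeps the net weight
-(-1)^k, and `correct_eq_alternating_sum` applies. -/
theorem altDE_mul_noDescent (hU : IsUnitInterval U) :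
    altDE U * PowerSeries.mk (noDescentSum U) = - correctSeries U := by
  ext n
  congr 1
  rw [PowerSeries.coeff_mul, map_neg]
  simp only [altDE, correctSeries, PowerSeries.coeff_mk]
  rcases n with _ | n
  · simp
  rw [if_neg n.succ_ne_zero, correct_eq_alternating_sum]
  simp only [mul_assoc ((-1) ^ _ * (_ : MvPolynomial U ℝ))]
  rw [sum_split hU n fun j => (-1) ^ j * (j : MvPolynomial U ℝ)]
  have key : ∀ m ≤ n + 1, ∑ j ∈ Finset.range m, (-1) ^ (j + 1) * ((j + 1 : ℕ) : MvPolynomial U ℝ) *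
      ((if j + 1 < n + 1 then descentSum U (n + 1) (j + 1) else 0) + descentSum U (n + 1) j) =
      (-1) ^ m * m * (if m < n + 1 then descentSum U (n + 1) m else 0) -
        ∑ k ∈ Finset.range m, (-1) ^ k * descentSum U (n + 1) k := by
    intro m hm
    induction m with
    | zero => simp
    | succ m ih =>
      rw [Finset.sum_range_succ, ih (by omega), if_pos (show m < n + 1 by omega),
        Finset.sum_range_succ]
      push_cast
      ring
  rw [key _ le_rfl, if_neg (lt_irrefl _)]
  simp

theorem restr_p (n : ℕ) {k : ℕ} (hk : k ≠ 0) : restr n (p k : MvPowerSeries ℕ ℝ) =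
    (MvPolynomial.psum (Fin n) ℝ k : MvPowerSeries (Fin n) ℝ) := by
  classical
  ext α
  rw [coeff_restr, p, coeff_mk, MvPolynomial.coeff_coe, MvPolynomial.psum, MvPolynomial.coeff_sum]
  simp only [MvPolynomial.coeff_X_pow]
  split_ifs with h
  · obtain ⟨i, hi⟩ := h
    have hmem : i ∈ (α.embDomain Fin.valEmbedding).support := by
      rw [hi]
      simp [hk]
    rw [Finsupp.support_embDomain, Finset.mem_map] at hmem
    obtain ⟨j, -, rfl⟩ := hmem
    rw [← Finsupp.embDomain_single, (Finsupp.embDomain_injective _).eq_iff] at hi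
    rw [Finset.sum_eq_single j, if_pos hi.symm]
    · intro j' _ hj'
      refine if_neg fun h => hj' ?_
      rw [hi] at h
      exact (Finsupp.single_left_inj hk).1 h
    · simp
  · refine (Finset.sum_eq_zero fun j _ => if_neg fun h' => h ⟨Fin.valEmbedding j, ?_⟩).symm
    rw [← h', Finsupp.embDomain_single]

/-- Each monomial involves finitely many variables, so identities in Λ may be checked on symmetric
polynomials. -/
theorem ext_restr {g h : SymFun} (H : ∀ n, restr n (g : MvPowerSeries ℕ ℝ) = restr n h) : g = h := by
  apply Subtype.ext
  ext α
  have hr : α ∈ Set.range (Finsupp.embDomain (M := ℕ)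
      (Fin.valEmbedding : Fin (α.support.sup id + 1) ↪ ℕ)) := by
    rw [Finsupp.mem_range_embDomain_iff]
    intro i hi
    exact ⟨⟨i, Nat.lt_succ_of_le (Finset.le_sup (f := id) hi)⟩, rfl⟩
  obtain ⟨β, hβ⟩ := hr
  rw [← hβ, ← coeff_restr, ← coeff_restr, H]

/-- Newton's identities. -/
theorem newton (k : ℕ) : (k : SymFun) * e k = (-1) ^ (k + 1) *
    ∑ a ∈ Finset.HasAntidiagonal.antidiagonal k with a.1 < k, (-1) ^ a.1 * e a.1 * p a.2 := by
  refine ext_restr fun n => ?_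
  have key := congrArg (MvPolynomial.coeToMvPowerSeries.ringHom (R := ℝ) (σ := Fin n))
    (MvPolynomial.mul_esymm_eq_sum (Fin n) ℝ k)
  simp only [map_mul, map_sum, map_pow, map_neg, map_one, map_natCast,
    MvPolynomial.coeToMvPowerSeries.ringHom_apply] at key
  have hcoe : ∀ g : SymFun, restr n (g : MvPowerSeries ℕ ℝ) =
      ((restr n).comp SymFun.val) g := fun g => rfl
  rw [hcoe, hcoe]
  simp only [map_mul, map_sum, map_pow, map_neg, map_one, map_natCast]
  simp only [← hcoe, restr_e]
  rw [key]
  congr 1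
  refine Finset.sum_congr rfl fun a ha => ?_
  rw [Finset.mem_filter, Finset.HasAntidiagonal.mem_antidiagonal] at ha
  rw [restr_p n (by omega)]

theorem e_zero : e 0 = 1 := by
  classical
  apply Subtype.ext
  ext α
  rw [coeff_e, OneMemClass.coe_one, MvPowerSeries.coeff_one]
  refine if_congr ⟨fun h => ?_, fun h => ?_⟩ rfl rfl
  · exact (Finsupp.degree_eq_zero_iff α).1 h.1
  · simp [h]

theorem gHom_e' {V : Type*} [Fintype V] (G : SimpleGraph V) (i : ℕ) : gHom G (e i) = eG G i := by
  rcases i with _ | i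
  · rw [e_zero, map_one, eG_zero]
  · exact gHom_e G i.succPNat

/-- `p_n^U` is the sum of the monomials of the correct words of length `n`. -/
theorem gHom_p (hU : IsUnitInterval U) {n : ℕ} (hn : n ≠ 0) :
    gHom (inc U) (p n) = wordSum fun u : Fin n → U => IsCorrect u := by
  -- The constant term is set to 0 because Newton's identities involve no p_0.
  let Q : PowerSeries (MvPolynomial U ℝ) :=
    PowerSeries.mk fun n => if n = 0 then 0 else gHom (inc U) (p n)
  have h1 : altE U * Q = - altDE U := by
    ext k
    congr 1
    have := congrArg (gHom (inc U)) (newton k)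
    simp only [map_mul, map_sum, map_pow, map_neg, map_one, map_natCast, gHom_e'] at this
    simp only [PowerSeries.coeff_mul, map_neg, altE, altDE, Q, PowerSeries.coeff_mk]
    rw [mul_assoc, this, pow_succ, ← mul_assoc, ← mul_assoc, ← pow_add, Even.neg_one_pow ⟨k, rfl⟩,
      one_mul, neg_one_mul, neg_neg, Finset.sum_filter]
    refine Finset.sum_congr rfl fun a ha => ?_
    have := Finset.HasAntidiagonal.mem_antidiagonal.1 ha
    by_cases h : a.1 < k
    · rw [if_pos h, if_neg (by omega)]
    · rw [if_neg h, if_pos (by omega), mul_zero]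
  -- Multiply `h1` by the series of descent-free words, the inverse of `altE U`.
  have h2 : Q = correctSeries U := by
    have h3 := altE_mul_noDescent hU
    have h4 := altDE_mul_noDescent hU
    linear_combination PowerSeries.mk (noDescentSum U) * h1 - Q * h3 - h4
  have := congrArg (PowerSeries.coeff n) h2
  simpa [Q, correctSeries, hn] using this

end Newton

/-! ### Products of two power sums -/

theorem support_map_eq_pair_iff {σ : Type*} {β : σ →₀ ℕ} {a b : ℕ} (ha : a ≠ 0) (hb : b ≠ 0) :
    β.support.val.map β = {a, b} ↔
      ∃ i j, i ≠ j ∧ Finsupp.single i a + Finsupp.single j b = β := by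
  classical
  constructor
  · intro h
    obtain ⟨i, hi, hia, h1⟩ := (Multiset.map_eq_cons _ _ _ _).2 h
    obtain ⟨j, hj, hjb⟩ := Multiset.map_eq_singleton.1 h1
    have hs : β.support.val = i ::ₘ {j} := by rw [← hj, Multiset.cons_erase hi]
    have hij : i ≠ j := by
      have := β.support.nodup
      rw [hs] at this
      simpa using this
    refine ⟨i, j, hij, ?_⟩
    ext x
    by_cases hx : x ∈ β.support
    · rw [← Finset.mem_val, hs, Multiset.mem_cons, Multiset.mem_singleton] at hx
      rcases hx with rfl | rfl
      · simp [hia, hij]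
      · simp [hjb, hij.symm]
    · have hx' := hx
      rw [← Finset.mem_val, hs, Multiset.mem_cons, Multiset.mem_singleton, not_or] at hx'
      rw [Finsupp.notMem_support_iff.1 hx]
      simp [hx'.1, hx'.2]
  · rintro ⟨i, j, hij, rfl⟩
    have hs : (Finsupp.single i a + Finsupp.single j b).support = {i, j} := by
      ext x
      rw [Finsupp.mem_support_iff, Finset.mem_insert, Finset.mem_singleton, Finsupp.add_apply]
      by_cases h1 : x = i
      · simp [h1, ha]
      · by_cases h2 : x = j
        · simp [h2, hb]
        · simp [h1, h2]
    rw [hs, Finset.insert_val_of_notMem (by simpa using hij)]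
    simp [hij, hij.symm]

theorem single_add_single_inj {σ : Type*} {i j i' j' : σ} {a b : ℕ} (ha : a ≠ 0)
    (hij : i ≠ j) (h : i' ≠ j')
    (H : Finsupp.single i' a + Finsupp.single j' b = Finsupp.single i a + Finsupp.single j b) :
    (i' = i ∧ Finsupp.single j' b = Finsupp.single j b) ∨ (i' = j ∧ a = b) := by
  classical
  by_cases h1 : i' = i
  · rw [h1, add_right_inj] at H
    exact Or.inl ⟨h1, H⟩
  · refine Or.inr ?_
    have := DFunLike.congr_fun H i'
    by_cases h2 : i' = j
    · refine ⟨h2, ?_⟩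
      rw [h2] at this h
      simpa [h.symm, hij] using this
    · exfalso
      simp [Ne.symm h, Ne.symm h1, Ne.symm h2] at this
      exact ha (by tauto)

theorem coeff_offDiag {n a b : ℕ} (β : Fin n →₀ ℕ) [DecidableEq (Fin n →₀ ℕ)] :
    MvPolynomial.coeff β (∑ x ∈ (Finset.univ : Finset (Fin n)).offDiag,
      (MvPolynomial.X x.1 ^ a * MvPolynomial.X x.2 ^ b : MvPolynomial (Fin n) ℝ)) =
    ∑ x ∈ (Finset.univ : Finset (Fin n)).offDiag,
      if Finsupp.single x.1 a + Finsupp.single x.2 b = β then 1 else 0 := by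
  rw [MvPolynomial.coeff_sum]
  refine Finset.sum_congr rfl fun x _ => ?_
  rw [MvPolynomial.X_pow_eq_monomial, MvPolynomial.X_pow_eq_monomial, MvPolynomial.monomial_mul,
    MvPolynomial.coeff_monomial, one_mul]
  congr

theorem coeff_restr_m (n : ℕ) (μ : Multiset ℕ+) (β : Fin n →₀ ℕ)
    [Decidable (β.support.val.map β = μ.map fun i : ℕ+ => (i : ℕ))] :
    MvPowerSeries.coeff β (restr n (m μ : MvPowerSeries ℕ ℝ)) =
      if β.support.val.map β = μ.map (fun i : ℕ+ => (i : ℕ)) then 1 else 0 := by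
  rw [coeff_restr, m, coeff_mk]
  have : exponents (β.embDomain Fin.valEmbedding) = β.support.val.map β := by
    unfold exponents
    rw [Finsupp.support_embDomain, Finset.map_val, Multiset.map_map]
    exact Multiset.map_congr rfl fun i _ => Finsupp.embDomain_apply_self _ _ _
  rw [this]
  congr

/-- The diagonal of the double sum for p_a p_b is p_{a+b}. -/
theorem restr_p_mul_p (n : ℕ) {a b : ℕ} (ha : a ≠ 0) (hb : b ≠ 0) :
    restr n ((p a * p b - p (a + b) : SymFun) : MvPowerSeries ℕ ℝ) =
      ((∑ x ∈ (Finset.univ : Finset (Fin n)).offDiag,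
        MvPolynomial.X x.1 ^ a * MvPolynomial.X x.2 ^ b : MvPolynomial (Fin n) ℝ) :
        MvPowerSeries (Fin n) ℝ) := by
  rw [AddSubgroupClass.coe_sub, MulMemClass.coe_mul, map_sub, map_mul, restr_p n ha, restr_p n hb,
    restr_p n (by omega), ← MvPolynomial.coe_mul, sub_eq_iff_eq_add, ← MvPolynomial.coe_add]
  congr 1
  unfold MvPolynomial.psum
  rw [Finset.sum_mul_sum, ← Finset.sum_product', ← Finset.diag_union_offDiag,
    Finset.sum_union (Finset.disjoint_diag_offDiag _), Finset.sum_diag, add_comm]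
  simp only [pow_add]

theorem p_mul_p_of_ne {a b : ℕ+} (h : a ≠ b) :
    p a * p b - p (a + b) = m {a, b} := by
  classical
  refine ext_restr fun n => ?_
  rw [restr_p_mul_p n a.ne_zero b.ne_zero]
  ext β
  rw [MvPolynomial.coeff_coe, coeff_offDiag, coeff_restr_m]
  have h1 : ({a, b} : Multiset ℕ+).map (fun i : ℕ+ => (i : ℕ)) = {(a : ℕ), (b : ℕ)} := rfl
  rw [h1]
  split_ifs with h2
  · obtain ⟨i, j, hij, rfl⟩ := (support_map_eq_pair_iff a.ne_zero b.ne_zero).1 h2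
    rw [Finset.sum_eq_single (i, j), if_pos rfl]
    · intro x hx hne
      rw [Finset.mem_offDiag] at hx
      refine if_neg fun H => hne ?_
      rcases single_add_single_inj a.ne_zero hij hx.2.2 H with ⟨h3, h4⟩ | ⟨-, h3⟩
      · exact Prod.ext h3 ((Finsupp.single_left_inj b.ne_zero).1 h4)
      · exact absurd (PNat.eq h3) h
    · simp [hij]
  · refine Finset.sum_eq_zero fun x hx => if_neg fun H => h2 ?_
    rw [Finset.mem_offDiag] at hx
    exact (support_map_eq_pair_iff a.ne_zero b.ne_zero).2 ⟨_, _, hx.2.2, H⟩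

/-- With equal exponents, the ordered pairs (i, j) and (j, i) give the same monomial, whence the
factor 2. -/
theorem p_mul_p_self (a : ℕ+) : p a * p a - p (a + a) = 2 * m {a, a} := by
  classical
  refine ext_restr fun n => ?_
  have h2 : ((2 * m {a, a} : SymFun) : MvPowerSeries ℕ ℝ) = m {a, a} + m {a, a} := by
    rw [two_mul, AddMemClass.coe_add]
  rw [restr_p_mul_p n a.ne_zero a.ne_zero, h2, map_add]
  ext β
  rw [MvPolynomial.coeff_coe, coeff_offDiag, map_add, coeff_restr_m]
  have h1 : ({a, a} : Multiset ℕ+).map (fun i : ℕ+ => (i : ℕ)) = {(a : ℕ), (a : ℕ)} := rfl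
  rw [h1]
  split_ifs with h2
  · obtain ⟨i, j, hij, rfl⟩ := (support_map_eq_pair_iff a.ne_zero a.ne_zero).1 h2
    rw [Finset.sum_eq_add (i, j) (j, i), if_pos rfl, if_pos (add_comm _ _)]
    · simp [hij]
    · intro x hx hne
      rw [Finset.mem_offDiag] at hx
      refine if_neg fun H => ?_
      rcases single_add_single_inj a.ne_zero hij hx.2.2 H with ⟨h3, h4⟩ | ⟨h3, -⟩
      · exact hne.1 (Prod.ext h3 ((Finsupp.single_left_inj a.ne_zero).1 h4))
      · rw [h3, add_comm, add_left_inj, Finsupp.single_left_inj a.ne_zero] at H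
        exact hne.2 (Prod.ext h3 H)
    · simp [hij]
    · simp [hij.symm]
  · rw [add_zero]
    refine Finset.sum_eq_zero fun x hx => if_neg fun H => h2 ?_
    rw [Finset.mem_offDiag] at hx
    exact (support_map_eq_pair_iff a.ne_zero a.ne_zero).2 ⟨_, _, hx.2.2, H⟩

/-! ### Monomial expansion of symmetric functions -/

/-- The numbers underlying a multiset of positive integers. -/
def natParts (μ : Multiset ℕ+) : Multiset ℕ := μ.map fun i : ℕ+ => (i : ℕ)

theorem natParts_injective : Function.Injective natParts :=
  Multiset.map_injective PNat.coe_injective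

theorem degree_eq_sum_exponents (α : ℕ →₀ ℕ) : (exponents α).sum = α.degree := rfl

theorem exists_exponents_eq (μ : Multiset ℕ+) : ∃ α : ℕ →₀ ℕ, exponents α = natParts μ := by
  induction μ using Multiset.induction_on with
  | empty => exact ⟨0, rfl⟩
  | cons a μ ih =>
    obtain ⟨α, hα⟩ := ih
    obtain ⟨i, hi⟩ := Infinite.exists_notMem_finset α.support
    have hi' := Finsupp.notMem_support_iff.1 hi
    have hs : (α + Finsupp.single i (a : ℕ)).support = Finset.cons i α.support hi := by
      ext j
      rw [Finsupp.mem_support_iff, Finset.mem_cons, Finsupp.mem_support_iff, Finsupp.add_apply]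
      by_cases hj : j = i
      · simp [hj]
      · simp [hj]
    refine ⟨α + Finsupp.single i (a : ℕ), ?_⟩
    rw [natParts, Multiset.map_cons, ← natParts, ← hα, exponents, exponents, hs, Finset.cons_val,
      Multiset.map_cons, Finsupp.add_apply, hi', Finsupp.single_eq_same, zero_add]
    congr 1
    refine Multiset.map_congr rfl fun j hj => ?_
    have : j ≠ i := fun h => hi (h ▸ hj)
    simp [this]

theorem exists_natParts_eq (α : ℕ →₀ ℕ) : ∃ μ : Multiset ℕ+, natParts μ = exponents α := by
  have h : ∀ i ∈ exponents α, 0 < i := by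
    intro i hi
    obtain ⟨j, hj, rfl⟩ := Multiset.mem_map.1 hi
    exact Nat.pos_of_ne_zero (Finsupp.mem_support_iff.1 hj)
  refine ⟨(exponents α).map Nat.toPNat', ?_⟩
  rw [natParts, Multiset.map_map]
  refine (Multiset.map_congr rfl fun i hi => ?_).trans (Multiset.map_id _)
  rw [Function.comp_apply, Nat.toPNat'_coe, if_pos (h i hi), id]

/-- Each value is taken equally often on both supports; matching the fibres gives a bijection of
finite supports, which extends to all of ℕ. -/
theorem exists_perm_of_exponents_eq {α β : ℕ →₀ ℕ} (h : exponents α = exponents β) :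
    ∃ s : Equiv.Perm ℕ, α.embDomain s.toEmbedding = β := by
  classical
  have hcard : ∀ (γ : ℕ →₀ ℕ) (c : ℕ),
      Fintype.card {i : {i // i ∈ γ.support} // γ i = c} = (exponents γ).count c := by
    intro γ c
    rw [exponents, Multiset.count_map, Fintype.card_subtype, ← Finset.filter_val, Finset.card_val]
    rw [← Finset.card_map (Function.Embedding.subtype _)]
    congr 1
    ext i
    simp only [Finset.mem_map, Finset.mem_filter, Finset.mem_univ, true_and,
      Function.Embedding.coe_subtype, Subtype.exists, exists_and_right, exists_eq_right]
    exact ⟨fun ⟨h1, h2⟩ => ⟨h1, h2.symm⟩, fun ⟨h1, h2⟩ => ⟨h1, h2.symm⟩⟩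
  let e1 : ∀ c, {i : {i // i ∈ α.support} // α i = c} ≃ {i : {i // i ∈ β.support} // β i = c} :=
    fun c => Fintype.equivOfCardEq (by rw [hcard, hcard, h])
  let e2 : {i // i ∈ α.support} ≃ {i // i ∈ β.support} := Equiv.ofFiberEquiv e1
  have he2 : ∀ i, β (e2 i) = α i := Equiv.ofFiberEquiv_map e1
  refine ⟨Equiv.extendSubtype (p := fun i => i ∈ α.support) (q := fun i => i ∈ β.support) e2, ?_⟩
  ext j
  obtain ⟨i, rfl⟩ := (Equiv.extendSubtype (p := fun i => i ∈ α.support)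
    (q := fun i => i ∈ β.support) e2).surjective j
  rw [← Equiv.coe_toEmbedding, Finsupp.embDomain_apply_self, Equiv.coe_toEmbedding]
  by_cases hi : i ∈ α.support
  · rw [Equiv.extendSubtype_apply_of_mem _ _ hi, he2]
  · rw [Finsupp.notMem_support_iff.1 hi]
    exact (Finsupp.notMem_support_iff.1 (Equiv.extendSubtype_not_mem e2 i hi)).symm

theorem coeff_eq_of_exponents_eq (g : SymFun) {α β : ℕ →₀ ℕ} (h : exponents α = exponents β) :
    MvPowerSeries.coeff α (g : MvPowerSeries ℕ ℝ) = MvPowerSeries.coeff β g := by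
  obtain ⟨s, rfl⟩ := exists_perm_of_exponents_eq h
  exact ((rename_eq_self_iff s _).1 (g.2.2 s) α).symm

theorem finite_partitions (n : ℕ) : {μ : Multiset ℕ+ | (natParts μ).sum = n}.Finite := by
  let F : {μ : Multiset ℕ+ | (natParts μ).sum = n} → Nat.Partition n := fun μ =>
    ⟨natParts μ.1, fun {i} hi => by
      obtain ⟨j, -, rfl⟩ := Multiset.mem_map.1 hi
      exact j.pos, μ.2⟩
  refine Finite.of_injective F fun μ ν h => ?_
  exact Subtype.ext (natParts_injective (congrArg Nat.Partition.parts h))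

/-- The partitions of `n`. -/
def partitions (n : ℕ) : Finset (Multiset ℕ+) := (finite_partitions n).toFinset

theorem mem_partitions {n : ℕ} {μ : Multiset ℕ+} : μ ∈ partitions n ↔ (natParts μ).sum = n :=
  (finite_partitions n).mem_toFinset

/-- An exponent vector with given nonzero exponents. -/
def expVec (μ : Multiset ℕ+) : ℕ →₀ ℕ := (exists_exponents_eq μ).choose

theorem exponents_expVec (μ : Multiset ℕ+) : exponents (expVec μ) = natParts μ :=
  (exists_exponents_eq μ).choose_spec

theorem coeff_sum_smul (s : Finset (Multiset ℕ+)) (c : Multiset ℕ+ → ℝ) (b : Multiset ℕ+ → SymFun)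
    (β : ℕ →₀ ℕ) : MvPowerSeries.coeff β ((∑ μ ∈ s, c μ • b μ : SymFun) : MvPowerSeries ℕ ℝ) =
      ∑ μ ∈ s, c μ * MvPowerSeries.coeff β (b μ : MvPowerSeries ℕ ℝ) := by
  rw [AddSubmonoidClass.coe_finsetSum, map_sum]
  exact Finset.sum_congr rfl fun μ _ => by rw [SetLike.val_smul, MvPowerSeries.coeff_smul]

/-- By symmetry the coefficients of g depend only on the multiset of exponents, and homogeneity
restricts these to the finitely many partitions of n. -/
theorem eq_sum_m (n : ℕ) (g : SymFun)
    (hg : ∀ α : ℕ →₀ ℕ, α.degree ≠ n → MvPowerSeries.coeff α (g : MvPowerSeries ℕ ℝ) = 0) :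
    g = ∑ μ ∈ partitions n,
      MvPowerSeries.coeff (expVec μ) (g : MvPowerSeries ℕ ℝ) • m μ := by
  classical
  apply Subtype.ext
  ext β
  rw [coeff_sum_smul]
  have hm : ∀ μ, MvPowerSeries.coeff β (m μ : MvPowerSeries ℕ ℝ) =
      if exponents β = natParts μ then 1 else 0 := by
    intro μ
    rw [m, coeff_mk]
    congr
  simp only [hm, mul_ite, mul_one, mul_zero]
  obtain ⟨ν, hν⟩ := exists_natParts_eq β
  by_cases hd : β.degree = n
  · rw [Finset.sum_eq_single ν, if_pos hν.symm]
    · refine coeff_eq_of_exponents_eq g ?_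
      rw [exponents_expVec, hν]
    · intro μ _ hμ
      refine if_neg fun h => hμ (natParts_injective ?_)
      rw [hν, h]
    · intro h
      rw [mem_partitions, hν, degree_eq_sum_exponents] at h
      exact absurd hd h
  · rw [hg β hd]
    refine (Finset.sum_eq_zero fun μ hμ => if_neg fun h => hd ?_).symm
    rw [← degree_eq_sum_exponents, h, mem_partitions.1 hμ]

/-! ### Symmetry of the matrix between elementary and monomial symmetric functions -/

/-- The product of the elementary symmetric functions indexed by the exponents of `x ^ α`. -/
def eExp (α : ℕ →₀ ℕ) : SymFun := ∏ i ∈ α.support, e (α i)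

theorem ePart_eq_eExp {μ : Multiset ℕ+} {α : ℕ →₀ ℕ} (h : natParts μ = exponents α) :
    ePart μ = eExp α := by
  have h1 : μ.map (fun i : ℕ+ => e (i : ℕ)) = (natParts μ).map e := by
    rw [natParts, Multiset.map_map]
    rfl
  rw [ePart, h1, h, exponents, Multiset.map_map]
  rfl

theorem coeff_eExp_of_degree_ne {α β : ℕ →₀ ℕ} (h : α.degree ≠ β.degree) :
    MvPowerSeries.coeff β (eExp α : MvPowerSeries ℕ ℝ) = 0 := by
  obtain ⟨μ, hμ⟩ := exists_natParts_eq α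
  rw [← ePart_eq_eExp hμ]
  refine MvPowerSeries.IsHomogeneous.coeff_eq_zero (isHomogeneous_ePart μ) ?_
  rw [← natParts, hμ, degree_eq_sum_exponents]
  exact h.symm

/-- The transpose of a finitely supported matrix. -/
def transpose (h : ℕ →₀ ℕ →₀ ℕ) : ℕ →₀ ℕ →₀ ℕ :=
  (Finsupp.equivMapDomain (Equiv.prodComm ℕ ℕ) h.uncurry).curry

theorem transpose_apply (h : ℕ →₀ ℕ →₀ ℕ) (i j : ℕ) : transpose h i j = h j i := by
  simp [transpose, Finsupp.uncurry_apply]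

theorem transpose_transpose (h : ℕ →₀ ℕ →₀ ℕ) : transpose (transpose h) = h := by
  ext i j
  rw [transpose_apply, transpose_apply]

/-- The zero-one matrices with row sums `α` and column sums `β`. -/
def zeroOneMatrices (α β : ℕ →₀ ℕ) : Set (ℕ →₀ ℕ →₀ ℕ) :=
  {h | (∀ i j, h i j ≤ 1) ∧ (∀ i, (h i).degree = α i) ∧ ∀ j, (transpose h j).degree = β j}

theorem degree_eq_sum_of_subset {α : ℕ →₀ ℕ} {s : Finset ℕ} (h : α.support ⊆ s) :
    α.degree = ∑ i ∈ s, α i := by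
  rw [Finsupp.degree_apply]
  exact Finset.sum_subset h fun i _ hi => Finsupp.notMem_support_iff.1 hi

/-- Choosing a squarefree monomial from each factor e_{α_i} amounts to choosing the rows of a
zero-one matrix; their product is x^β when the column sums are β. -/
theorem coeff_eExp (α β : ℕ →₀ ℕ) :
    MvPowerSeries.coeff β (eExp α : MvPowerSeries ℕ ℝ) = Nat.card (zeroOneMatrices α β) := by
  classical
  have h1 : (eExp α : MvPowerSeries ℕ ℝ) = ∏ i ∈ α.support, (e (α i) : MvPowerSeries ℕ ℝ) :=
    map_prod SymFun.val _ _
  rw [h1, MvPowerSeries.coeff_prod]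
  simp only [coeff_e, Finset.prod_ite_zero, Finset.prod_const_one, Finset.sum_boole]
  rw [Nat.cast_inj]
  refine (Nat.subtype_card _ fun h => ?_).symm
  rw [Finset.mem_filter, Finset.mem_finsuppAntidiag]
  have hdeg : h.support ⊆ α.support → ∀ j, (transpose h j).degree = ∑ i ∈ α.support, h i j := by
    intro hs j
    rw [degree_eq_sum_of_subset (s := α.support)]
    · exact Finset.sum_congr rfl fun i _ => transpose_apply _ _ _
    · intro i hi
      rw [Finsupp.mem_support_iff, transpose_apply] at hi
      refine hs (Finsupp.mem_support_iff.2 fun h0 => hi ?_)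
      rw [h0, Finsupp.zero_apply]
  constructor
  · rintro ⟨⟨h2, h3⟩, h4⟩
    have hz : ∀ i, i ∉ α.support → h i = 0 := fun i hi =>
      Finsupp.notMem_support_iff.1 fun h' => hi (h3 h')
    refine ⟨fun i j => ?_, fun i => ?_, fun j => ?_⟩
    · by_cases hi : i ∈ α.support
      · exact (h4 i hi).2 j
      · simp [hz i hi]
    · by_cases hi : i ∈ α.support
      · exact (h4 i hi).1
      · rw [hz i hi, Finsupp.notMem_support_iff.1 hi, map_zero]
    · rw [hdeg h3, ← h2, Finsupp.finsetSum_apply]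
  · rintro ⟨h2, h3, h4⟩
    have hs : h.support ⊆ α.support := by
      intro i hi
      rw [Finsupp.mem_support_iff] at hi ⊢
      intro h0
      refine hi ((Finsupp.degree_eq_zero_iff _).1 ?_)
      rw [h3, h0]
    refine ⟨⟨?_, hs⟩, fun i _ => ⟨h3 i, h2 i⟩⟩
    ext j
    rw [Finsupp.finsetSum_apply, ← hdeg hs, h4]

theorem coeff_eExp_comm (α β : ℕ →₀ ℕ) : MvPowerSeries.coeff β (eExp α : MvPowerSeries ℕ ℝ) =
    MvPowerSeries.coeff α (eExp β : MvPowerSeries ℕ ℝ) := by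
  rw [coeff_eExp, coeff_eExp, Nat.cast_inj]
  have hmem : ∀ {α β h}, h ∈ zeroOneMatrices α β → transpose h ∈ zeroOneMatrices β α := by
    rintro α β h ⟨h1, h2, h3⟩
    refine ⟨fun i j => ?_, h3, ?_⟩
    · rw [transpose_apply]
      exact h1 j i
    · rwa [transpose_transpose]
  exact Nat.card_congr ⟨fun h => ⟨_, hmem h.2⟩, fun h => ⟨_, hmem h.2⟩,
    fun h => Subtype.ext (transpose_transpose _), fun h => Subtype.ext (transpose_transpose _)⟩

/-! ### The coefficients of the chromatic symmetric function -/

section Chromatic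

variable {V : Type*} [Fintype V] (G : SimpleGraph V)

variable (V) in
/-- The exponent vector of the product of all variables. -/
def allOnes : V →₀ ℕ := ∑ v, Finsupp.single v 1

/-- The coefficient of `∏ v` in `f^G`. -/
def squarefreeCoeff : SymFun →ₗ[ℝ] ℝ :=
  (MvPolynomial.lcoeff ℝ (allOnes V)).comp (gHom G).toLinearMap

theorem squarefreeCoeff_apply (g : SymFun) :
    squarefreeCoeff G g = MvPolynomial.coeff (allOnes V) (gHom G g) := rfl

theorem allOnes_apply (v : V) : allOnes V v = 1 := by
  classical
  simp [allOnes, Finsupp.finsetSum_apply, Finsupp.single_apply]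

/-- The proper colourings of type `β`. -/
abbrev Colorings (β : ℕ →₀ ℕ) : Type _ :=
  {c : V → ℕ // (∀ u v, G.Adj u v → c u ≠ c v) ∧ ∑ v, Finsupp.single (c v) 1 = β}

/-- The ordered partitions of `V` into stable sets with cardinalities given by `β`. -/
def StablePartition (β : ℕ →₀ ℕ) (φ : (i : β.support) → Finset V) : Prop :=
  (∀ i, (φ i).card = β i ∧ G.IsIndepSet (φ i : Set V)) ∧ ∀ v, ∃! i, v ∈ φ i

theorem sum_single_apply [DecidableEq V] (c : V → ℕ) (i : ℕ) :
    (∑ v, Finsupp.single (c v) 1 : ℕ →₀ ℕ) i = (Finset.univ.filter fun v => c v = i).card := by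
  rw [Finsupp.finsetSum_apply, Finset.card_filter]
  exact Finset.sum_congr rfl fun v _ => Finsupp.single_apply

theorem colorings_mem_support {β : ℕ →₀ ℕ} (c : Colorings G β) (v : V) : c.1 v ∈ β.support := by
  classical
  have h : β (c.1 v) = _ := (DFunLike.congr_fun c.2.2 _).symm.trans (sum_single_apply c.1 (c.1 v))
  rw [Finsupp.mem_support_iff, h, Finset.card_ne_zero]
  exact ⟨v, by simp⟩

/-- A proper colouring is determined by its colour classes, which are stable. -/
theorem card_colorings (β : ℕ →₀ ℕ) :
    Nat.card (Colorings G β) = Nat.card {φ : (i : β.support) → Finset V // StablePartition G β φ} := by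
  classical
  let F : Colorings G β → {φ : (i : β.support) → Finset V // StablePartition G β φ} := fun c =>
    ⟨fun i => Finset.univ.filter fun v => c.1 v = i, fun i => ⟨?_, ?_⟩, fun v => ?_⟩
  refine Nat.card_eq_of_bijective F ⟨fun c c' h => Subtype.ext (funext fun v => ?_), fun φ => ?_⟩
  · have hv := colorings_mem_support G c v
    have h1 : (Finset.univ.filter fun u => c.1 u = c.1 v) =
        Finset.univ.filter fun u => c'.1 u = c.1 v :=
      congrFun (congrArg Subtype.val h) ⟨c.1 v, hv⟩
    have h2 : v ∈ Finset.univ.filter fun u => c.1 u = c.1 v := by simp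
    have h3 : v ∈ Finset.univ.filter fun u => c'.1 u = c.1 v := h1 ▸ h2
    exact (Finset.mem_filter.1 h3).2.symm
  · obtain ⟨φ, h1, h2⟩ := φ
    choose k hk hk' using fun v => h2 v
    have hiff : ∀ v i, v ∈ φ i ↔ (k v : ℕ) = i := fun v i =>
      ⟨fun h => by rw [hk' v i h], fun h => by rw [← Subtype.ext h]; exact hk v⟩
    refine ⟨⟨fun v => k v, fun u v huv h => ?_, ?_⟩, ?_⟩
    · have := (hiff u (k v)).2 h
      exact (h1 (k v)).2 this (hk v) huv.ne huv
    · ext i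
      rw [sum_single_apply]
      by_cases hi : i ∈ β.support
      · rw [← (h1 ⟨i, hi⟩).1]
        congr 1
        ext v
        simp [hiff]
      · rw [Finsupp.notMem_support_iff.1 hi, Finset.card_eq_zero, Finset.filter_eq_empty_iff]
        rintro v - rfl
        exact hi (k v).2
    · refine Subtype.ext (funext fun i => ?_)
      ext v
      simp [F, hiff]
  · change (Finset.univ.filter fun v => c.1 v = i).card = β i
    rw [← sum_single_apply, c.2.2]
  · intro u hu v hv _ huv
    rw [Finset.coe_filter] at hu hv
    exact c.2.1 u v huv (hu.2.trans hv.2.symm)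
  · have hv := colorings_mem_support G c v
    refine ⟨⟨c.1 v, hv⟩, by simp, fun i hi => Subtype.ext ?_⟩
    exact (Finset.mem_filter.1 hi).2.symm

/-- Expanding the product of the e_{β_i}^G, a choice of stable sets gives the squarefree full
monomial exactly when every vertex is covered once. -/
theorem squarefreeCoeff_eExp (β : ℕ →₀ ℕ) :
    squarefreeCoeff G (eExp β) = Nat.card (Colorings G β) := by
  classical
  have h1 : gHom G (eExp β) = ∏ i : β.support, eG G (β i) := by
    rw [eExp, map_prod, ← Finset.prod_coe_sort]
    exact Finset.prod_congr rfl fun i _ => gHom_e' G _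
  have hX : ∀ S : Finset V, (∏ v ∈ S, MvPolynomial.X v : MvPolynomial V ℝ) =
      MvPolynomial.monomial (∑ v ∈ S, Finsupp.single v 1) 1 := fun S => by
    rw [MvPolynomial.monomial_sum_one]
    rfl
  rw [squarefreeCoeff_apply, h1]
  unfold eG
  rw [Finset.prod_univ_sum, MvPolynomial.coeff_sum]
  simp only [hX, ← MvPolynomial.monomial_sum_one, MvPolynomial.coeff_monomial, Finset.sum_boole]
  rw [Nat.cast_inj, card_colorings]
  refine (Nat.subtype_card _ fun φ => ?_).symm
  rw [Finset.mem_filter, Fintype.mem_piFinset]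
  refine and_congr (forall_congr' fun i => by simp) ?_
  rw [Finsupp.ext_iff]
  refine forall_congr' fun v => ?_
  have h2 : (∑ i, ∑ v ∈ φ i, Finsupp.single v 1 : V →₀ ℕ) v =
      (Finset.univ.filter fun i => v ∈ φ i).card := by
    rw [Finset.card_filter, Finsupp.finsetSum_apply]
    refine Finset.sum_congr rfl fun i _ => ?_
    simp [Finsupp.finsetSum_apply, Finsupp.single_apply]
  rw [h2, allOnes_apply, Finset.card_eq_one]
  constructor
  · rintro ⟨i, hi⟩
    have h3 : ∀ j, v ∈ φ j ↔ j = i := fun j => by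
      rw [← Finset.mem_singleton, ← hi, Finset.mem_filter]
      simp
    exact ⟨i, (h3 i).2 rfl, fun j hj => (h3 j).1 hj⟩
  · rintro ⟨i, hi, hi'⟩
    refine ⟨i, ?_⟩
    ext j
    rw [Finset.mem_filter, Finset.mem_singleton]
    exact ⟨fun h => hi' j h.2, fun h => ⟨Finset.mem_univ _, h ▸ hi⟩⟩

/-- Stanley's theorem: `X_G = ∑ c_μ e_μ`, where `c_μ` is the coefficient of `∏ v` in `m_μ^G`. -/
theorem chromatic_eq_sum : chromatic G =
    ∑ μ ∈ partitions (Fintype.card V), squarefreeCoeff G (m μ) • ePart μ := by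
  apply Subtype.ext
  ext β
  rw [coeff_sum_smul]
  have hcol : MvPowerSeries.coeff β (chromatic G : MvPowerSeries ℕ ℝ) =
      Nat.card (Colorings G β) := rfl
  rw [hcol]
  have hexp : ∀ μ, ePart μ = eExp (expVec μ) := fun μ => ePart_eq_eExp (exponents_expVec μ).symm
  simp only [hexp]
  by_cases hd : β.degree = Fintype.card V
  -- The number of colourings of type β is a linear functional evaluated at the product of the
  -- e_{β_i}. Expanding this product in the m_μ and applying `coeff_eExp_comm` gives the coefficient
  -- of x^β on the right.
  · rw [← squarefreeCoeff_eExp]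
    conv_lhs => rw [eq_sum_m (Fintype.card V) (eExp β) fun α hα =>
      coeff_eExp_of_degree_ne (hd.trans_ne hα.symm)]
    rw [map_sum]
    refine Finset.sum_congr rfl fun μ _ => ?_
    rw [map_smul, smul_eq_mul, mul_comm, coeff_eExp_comm]
  · have : IsEmpty (Colorings G β) := ⟨fun c => hd (by
      have := c.2.2
      rw [← this, map_sum]
      simp)⟩
    rw [Nat.card_of_isEmpty, Nat.cast_zero]
    refine (Finset.sum_eq_zero fun μ hμ => ?_).symm
    rw [coeff_eExp_of_degree_ne, mul_zero]
    rw [← degree_eq_sum_exponents, exponents_expVec, mem_partitions.1 hμ]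
    exact Ne.symm hd

theorem eCoeff_eq {μ : Multiset ℕ+} (hμ : (natParts μ).sum = Fintype.card V) :
    eCoeff G μ = squarefreeCoeff G (m μ) := by
  classical
  rw [eCoeff, chromatic_eq_sum, map_sum, Finsupp.finsetSum_apply]
  rw [Finset.sum_eq_single μ]
  · rw [map_smul, ← eBasis_apply, Module.Basis.repr_self, Finsupp.smul_apply,
      Finsupp.single_eq_same, smul_eq_mul, mul_one]
  · intro ν _ hν
    rw [map_smul, ← eBasis_apply, Module.Basis.repr_self, Finsupp.smul_apply,
      Finsupp.single_eq_of_ne (Ne.symm hν), smul_zero]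
  · exact fun h => absurd (mem_partitions.2 hμ) h

end Chromatic

/-! ### Positivity and conclusion -/

section Final

variable {U : Type*}

theorem coeff_wordMonomial_nonneg {n : ℕ} (u : Fin n → U) (d : U →₀ ℕ) :
    0 ≤ MvPolynomial.coeff d (wordMonomial u) := by
  classical
  have : wordMonomial u = MvPolynomial.monomial (∑ i, Finsupp.single (u i) 1) 1 := by
    rw [MvPolynomial.monomial_sum_one]
    rfl
  rw [this, MvPolynomial.coeff_monomial]
  split_ifs <;> norm_num

variable [PartialOrder U] [Fintype U]

theorem coeff_MSum_nonneg (l : ℕ) (d : U →₀ ℕ) : 0 ≤ MvPolynomial.coeff d (MSum U l) := by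
  classical
  unfold MSum
  rw [MvPolynomial.coeff_sum]
  refine Finset.sum_nonneg fun x _ => ?_
  change 0 ≤ MvPolynomial.coeff d (wordMonomial x.1 * wordMonomial x.2)
  rw [MvPolynomial.coeff_mul]
  exact Finset.sum_nonneg fun y _ =>
    mul_nonneg (coeff_wordMonomial_nonneg _ _) (coeff_wordMonomial_nonneg _ _)

theorem gHom_p_mul_p (hU : IsUnitInterval U) {l : ℕ} (hl : 2 ≤ l) :
    gHom (inc U) (p l) * gHom (inc U) (p 2) - gHom (inc U) (p (l + 2)) = MSum U l := by
  rw [gHom_p hU (by omega), gHom_p hU two_ne_zero, gHom_p hU (by omega),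
    correct_mul_correct_sub hU hl]

theorem gHom_m (hU : IsUnitInterval U) {l : ℕ} (h0 : 0 < l) (hl : 3 ≤ l) :
    gHom (inc U) (m {⟨l, h0⟩, 2}) = MSum U l := by
  have h : @Ne ℕ+ ⟨l, h0⟩ 2 := fun h => by
    have : l = 2 := congrArg (fun a : ℕ+ => (a : ℕ)) h
    omega
  rw [← p_mul_p_of_ne h, map_sub, map_mul]
  exact gHom_p_mul_p hU (show 2 ≤ l by omega)

theorem two_mul_gHom_m (hU : IsUnitInterval U) : 2 * gHom (inc U) (m {2, 2}) = MSum U 2 := by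
  have := congrArg (gHom (inc U)) (p_mul_p_self 2)
  rw [map_sub, map_mul, map_mul, map_ofNat] at this
  rw [← this]
  exact gHom_p_mul_p hU le_rfl

/-- The coefficient of the product of all vertices is read off from a sum of monomials; for four
vertices this sum is twice m_{2,2}^U, which does not affect the sign. -/
theorem eCoeff_nonneg (hU : IsUnitInterval U) (h0 : 0 < Fintype.card U - 2)
    (h : 4 ≤ Fintype.card U) : 0 ≤ eCoeff (inc U) {⟨Fintype.card U - 2, h0⟩, 2} := by
  rw [eCoeff_eq, squarefreeCoeff_apply]
  · by_cases h5 : 3 ≤ Fintype.card U - 2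
    · rw [gHom_m hU h0 h5]
      exact coeff_MSum_nonneg _ _
    · have h2 : @Eq ℕ+ ⟨Fintype.card U - 2, h0⟩ 2 :=
        PNat.eq (show Fintype.card U - 2 = 2 by omega)
      rw [h2]
      have := coeff_MSum_nonneg 2 (allOnes U)
      rw [← two_mul_gHom_m hU, two_mul, MvPolynomial.coeff_add] at this
      linarith
  · change Fintype.card U - 2 + 2 = _
    omega

end Final

end ChromSym

end

theorem mainTheorem3 {U : Type*} [Fintype U] [PartialOrder U] (hU : ChromSym.IsUnitInterval U) :
    (∀ (l : ℕ) (hl : 3 ≤ l),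
      ChromSym.gHom (ChromSym.inc U) (ChromSym.m {⟨l, by omega⟩, 2}) = ChromSym.MSum U l) ∧
    2 * ChromSym.gHom (ChromSym.inc U) (ChromSym.m {2, 2}) = ChromSym.MSum U 2 ∧
    (∀ l : ℕ, 2 ≤ l →
      ChromSym.gHom (ChromSym.inc U) (ChromSym.p l) * ChromSym.gHom (ChromSym.inc U) (ChromSym.p 2)
        - ChromSym.gHom (ChromSym.inc U) (ChromSym.p (l + 2)) = ChromSym.MSum U l) ∧
    ∀ h : 4 ≤ Fintype.card U,
      0 ≤ ChromSym.eCoeff (ChromSym.inc U) {⟨Fintype.card U - 2, by omega⟩, 2} :=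
  ⟨fun _ hl => ChromSym.gHom_m hU _ hl, ChromSym.two_mul_gHom_m hU,
    fun _ hl => ChromSym.gHom_p_mul_p hU hl, fun h => ChromSym.eCoeff_nonneg hU _ h⟩
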